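/- For elements $q,a$ of a commutative ring and an integer $z\ge 0$ put $(a)_z=\prod_{j=0}^{z-1}(1-aq^j)$, and let $\begin{bmatrix} m\\ c\end{bmatrix}_q=(q^{m-c+1})_c/(q)_c$ for integers $m,c\ge 0$. Let $n_0,\dots,n_p$ be nonnegative integers, $n=n_0+\cdots+n_p$, and let $N_l=\{n_0+\cdots+n_{l-1}+1,\dots,n_0+\cdots+n_l\}$ for $l=0,\dots,p$. Put $\varepsilon_{ij}=1$ if $\{i,j\}\subseteq N_l$ for some $l\in\{1,\dots,p\}$, and $\varepsilon_{ij}=0$ otherwise. For integers $a,b,c\ge 0$ let $D_n((n_0,\dots,n_p);a,b,c)$ be the constant term with respect to $x_1,\dots,x_n$ of the (homogeneous of degree $0$) Laurent polynomial $$\prod_{i=1}^n (x_0/x_i)_a(qx_i/x_0)_b\prod_{1\le i<j\le n}(x_i/x_j)_{c+\varepsilon_{ij}}(qx_j/x_i)_{c+\varepsilon_{ij}}.$$ Let $c\ge 0$ be an integer, and let $q$ be a nonzero element of a field with $q^m\ne 1$ for $1\le m\le c+1$ (for instance an indeterminate, or a nonzero complex number that is not a root of unity). Let $k\in\{1,\dots,p\}$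 be any index with $n_k=\max\{n_1,\dots,n_p\}$ ($n_0$ is not included in the maximum), and assume $n_k\ge 1$. Then $$D_n\big((n_0,\dots,n_p);0,0,c\big)=\frac{1-q^{n_k(c+1)}}{1-q^{c+1}}\begin{bmatrix} nc+n_k-1\\ c\end{bmatrix}_q D_{n-1}\big((n_0,\dots,n_{k-1},n_k-1,n_{k+1},\dots,n_p);0,0,c\big).$$ -/

import Mathlib

open Finset

noncomputable section

namespace BakerForrester

/-- The `q`-shifted factorial `(a)_z = (a; q)_z = ∏_{j=0}^{z-1} (1 - a q^j)`. -/
def qPoch {A : Type*} [CommRing A] (q a : A) (z : ℕ) : A :=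
  ∏ j ∈ range z, (1 - a * q ^ j)

/-- The `q`-binomial coefficient `(q^{n-c+1})_c / (q)_c`. For `c ≤ n` the exponent `n + 1 - c` is
exact; for `n < c` it is `0` and the value is `0`, as it is with the exponent `n - c + 1` in `ℤ`. -/
def qBinom {K : Type*} [Field K] (q : K) (n c : ℕ) : K :=
  qPoch q (q ^ (n + 1 - c)) c / qPoch q q c

/-- Laurent polynomials over `K` in the variables `x_0, x_1, x_2, …`. An exponent vector is a
finitely supported function `ℕ →₀ ℤ`. -/
abbrev Laurent (K : Type*) [Field K] : Type _ := AddMonoidAlgebra K (ℕ →₀ ℤ)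

/-- The Laurent monomial `x_i / x_j`. -/
def ratio (K : Type*) [Field K] (i j : ℕ) : Laurent K :=
  AddMonoidAlgebra.single (Finsupp.single i 1 - Finsupp.single j 1) 1

/-- The scalar `q` as a Laurent polynomial. -/
def scalar {K : Type*} [Field K] (q : K) : Laurent K := algebraMap K (Laurent K) q

/-- The block `N_l = {n_0 + ⋯ + n_{l-1} + 1, …, n_0 + ⋯ + n_l}`. -/
def block {p : ℕ} (n : Fin (p + 1) → ℕ) (l : Fin (p + 1)) : Finset ℕ :=
  Icc ((∑ m ∈ Iio l, n m) + 1) (∑ m ∈ Iic l, n m)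

/-- `ε_{ij} = 1` if `i` and `j` lie in a common block `N_l` with `1 ≤ l ≤ p`, and `0` otherwise. -/
def eps {p : ℕ} (n : Fin (p + 1) → ℕ) (i j : ℕ) : ℕ :=
  if ∃ l : Fin (p + 1), l ≠ 0 ∧ i ∈ block n l ∧ j ∈ block n l then 1 else 0

/-- The Laurent polynomial `L_{n_0,…,n_p}(a,b,c;x)` in `x_0, …, x_N`, where `N = n_0 + ⋯ + n_p`:
`∏_{1≤i≤N} (x_0/x_i)_a (q x_i/x_0)_b ∏_{1≤i<j≤N} (x_i/x_j)_{c+ε_{ij}} (q x_j/x_i)_{c+ε_{ij}}`. -/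
def bfProduct {K : Type*} [Field K] (q : K) {p : ℕ} (n : Fin (p + 1) → ℕ) (a b c : ℕ) :
    Laurent K :=
  (∏ i ∈ Icc 1 (∑ m, n m),
      qPoch (scalar q) (ratio K 0 i) a * qPoch (scalar q) (scalar q * ratio K i 0) b) *
    ∏ i ∈ Icc 1 (∑ m, n m), ∏ j ∈ Ioc i (∑ m, n m),
      qPoch (scalar q) (ratio K i j) (c + eps n i j) *
        qPoch (scalar q) (scalar q * ratio K j i) (c + eps n i j)

/-- Every monomial of `L_{n_0,…,n_p}(a,b,c;x)` has total degree `0`. Hence the only monomial that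
is free of `x_1, x_2, …` is the monomial `1`, and the constant term with respect to `x_1, …, x_N`
is the coefficient of `1`. -/
theorem bfProduct_homogeneous {K : Type*} [Field K] (q : K) {p : ℕ} (n : Fin (p + 1) → ℕ)
    (a b c : ℕ) (e : ℕ →₀ ℤ) (he : (bfProduct q n a b c).coeff e ≠ 0) :
    (e.sum fun _ z => z) = 0 := by
  let deg : (ℕ →₀ ℤ) →+ ℤ := Finsupp.liftAddHom fun _ => AddMonoidHom.id ℤ
  let S : Subalgebra K (Laurent K) :=
    SetLike.GradeZero.subalgebra (AddMonoidAlgebra.gradeBy K deg)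
  have hs : ∀ t : K, scalar t ∈ S := fun t => S.algebraMap_mem t
  have hr : ∀ i j : ℕ, ratio K i j ∈ S := by
    intro i j
    have h := AddMonoidAlgebra.single_mem_gradeBy (R := K) deg
      (Finsupp.single i 1 - Finsupp.single j 1) 1
    have h0 : deg (Finsupp.single i 1 - Finsupp.single j 1) = 0 := by
      rw [map_sub]
      simp [deg]
    rw [h0] at h
    exact h
  have hp : ∀ (f : Laurent K) (z : ℕ), f ∈ S → qPoch (scalar q) f z ∈ S := by
    intro f z hf
    exact S.prod_mem fun j _ => S.sub_mem S.one_mem (S.mul_mem hf (S.pow_mem (hs q) j))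
  have hL : bfProduct q n a b c ∈ S := by
    refine S.mul_mem (S.prod_mem fun i _ => ?_) (S.prod_mem fun i _ => S.prod_mem fun j _ => ?_)
    · exact S.mul_mem (hp _ _ (hr _ _)) (hp _ _ (S.mul_mem (hs q) (hr _ _)))
    · exact S.mul_mem (hp _ _ (hr _ _)) (hp _ _ (S.mul_mem (hs q) (hr _ _)))
  have hm : bfProduct q n a b c ∈ AddMonoidAlgebra.gradeBy K deg 0 := hL
  exact (AddMonoidAlgebra.mem_gradeBy_iff K deg 0 _).1 hm (Finsupp.mem_support_iff.2 he)

/-- `D_N((n_0,…,n_p);a,b,c)`, where `N = n_0 + ⋯ + n_p`: the constant term of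
`L_{n_0,…,n_p}(a,b,c;x)` with respect to `x_1, …, x_N`. By `bfProduct_homogeneous` it does not
involve `x_0`, so it is the coefficient of the monomial `1`. -/
def bfConst {K : Type*} [Field K] (q : K) {p : ℕ} (n : Fin (p + 1) → ℕ) (a b c : ℕ) : K :=
  (bfProduct q n a b c).coeff 0

end BakerForrester

end

noncomputable section

namespace BakerForrester

/-! The recursion removes one variable from the block `k`, in three moves. Put `t = q ^ (c + 1)`.
The substitution `x_i ↦ q x_i` for all `i` up to the end of block `k` leaves the constant term alone
and moves that block to the end of a cyclic order of the variables. Clearing denominators turns the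
constant term into one coefficient `ctCoeff` of a homogeneous polynomial `ctPoly`, with `w` outer
variables followed by the block. Next, `ctPoly` is a product of `∏ (x_i - t x_j)` over block pairs
and a factor antisymmetric in the block. Coefficient extraction against that factor is an
antisymmetric functional, and under such a functional `∏ (x_i - t x_o)`, with `x_o` the last block
variable, may be replaced by `(1 + t + ⋯ + t ^ m) ∏ x_i` (`map_rename_mul_prod_sub`). This produces
the quotient `(1 - q ^ (n_k (c + 1))) / (1 - q ^ (c + 1))`. What is left is a coefficient in which
`x_o` meets every other variable through a `pairFactor`. The interpolation formula
`coeff_eq_sum_piFinset` writes it, and the coefficient without `x_o`, as sums over grids of powers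
of `q`. A nonzero term of the larger sum forces disjoint intervals of exponents to fill an initial
segment of `ℕ` (`intervals_tile`), so `x_o` sits at `q ^ 0` and the other variables form a shifted
term of the smaller sum. The ratio of corresponding terms is constant and gives the `q`-binomial
coefficient (`coeff_mul_prod_pairFactor`). Maximality of `n_k` is what makes the grids small enough
for the intervals to fit. Interpolation needs distinct powers of `q`, and antisymmetry needs
characteristic zero. Both hold in the fraction field of `ℤ[X]` with `q = X`; the identity, free of
denominators, then specializes to every commutative ring (`ctCoeff_succ`). -/

/-- The homogeneous form `y^a x^b (x/y)_a (q y/x)_b` of a pair of shifted factorials. -/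
def pairFactor {S : Type*} [CommRing S] (q x y : S) (a b : ℕ) : S :=
  (∏ r ∈ range a, (y - q ^ r * x)) * ∏ r ∈ range b, (x - q ^ (r + 1) * y)

theorem map_pairFactor {S T : Type*} [CommRing S] [CommRing T] (f : S →+* T) (q x y : S)
    (a b : ℕ) : f (pairFactor q x y a b) = pairFactor (f q) (f x) (f y) a b := by
  simp [pairFactor]

/-! ### Coefficients of homogeneous polynomials by interpolation on grids -/

section Interpolation

variable {K : Type*} [Field K]

/-- This is the leading coefficient in Lagrange interpolation of `X ^ m` at `d + 1` nodes, that is,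
a divided difference of order `d`. -/
theorem sum_pow_div_prod_sub {d m : ℕ} {v : ℕ → K} (hv : Set.InjOn v (range (d + 1)))
    (hm : m ≤ d) :
    ∑ k ∈ range (d + 1), v k ^ m / ∏ l ∈ (range (d + 1)).erase k, (v k - v l) =
      if m = d then 1 else 0 := by
  have h := Lagrange.coeff_eq_sum (s := range (d + 1)) (P := (Polynomial.X ^ m : Polynomial K)) hv
    (by rw [Polynomial.degree_X_pow, card_range]; exact_mod_cast Nat.lt_succ_of_le hm)
  simp only [Polynomial.eval_pow, Polynomial.eval_X, card_range, Nat.add_sub_cancel,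
    Polynomial.coeff_X_pow] at h
  rw [← h]
  simp [eq_comm]

/-- The coefficient formula behind the Combinatorial Nullstellensatz. -/
theorem coeff_eq_sum_piFinset {ι : Type*} [Fintype ι] [DecidableEq ι] {f : MvPolynomial ι K}
    {d : ι → ℕ} {v : ι → ℕ → K} (hv : ∀ i, Set.InjOn (v i) (range (d i + 1)))
    (hf : f.IsHomogeneous (∑ i, d i)) :
    f.coeff (Finsupp.equivFunOnFinite.symm d) =
      ∑ k ∈ Fintype.piFinset fun i => range (d i + 1),
        MvPolynomial.eval (fun i => v i (k i)) f /
          ∏ i, ∏ l ∈ (range (d i + 1)).erase (k i), (v i (k i) - v i l) := by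
  have h1 : ∀ e ∈ f.support, f.coeff e * (∏ i, ∑ k ∈ range (d i + 1), v i k ^ e i /
      ∏ l ∈ (range (d i + 1)).erase k, (v i k - v i l)) =
      if e = Finsupp.equivFunOnFinite.symm d then f.coeff e else 0 := by
    intro e he
    have hdeg : ∑ i, e i = ∑ i, d i := by
      have := hf (MvPolynomial.mem_support_iff.1 he)
      rw [← this, Finsupp.weight_apply, Finsupp.sum_fintype _ _ (by simp)]
      simp
    split_ifs with h
    · subst h
      rw [prod_eq_one, mul_one]
      intro i _
      exact (sum_pow_div_prod_sub (hv i) le_rfl).trans (if_pos rfl)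
    -- All monomials have the same total degree, so one other than `d` is below `d` in some
    -- variable, and the divided difference in that variable kills it.
    · have : ∃ i, e i < d i := by
        by_contra! hle
        refine h (Finsupp.ext fun i => ?_)
        exact ((sum_eq_sum_iff_of_le fun i _ => hle i).1 hdeg.symm i (mem_univ i)).symm
      obtain ⟨i, hi⟩ := this
      rw [prod_eq_zero (mem_univ i), mul_zero]
      rw [sum_pow_div_prod_sub (hv i) hi.le, if_neg hi.ne]
  have h2 : ∑ e ∈ f.support, (if e = Finsupp.equivFunOnFinite.symm d then f.coeff e else 0) =
      f.coeff (Finsupp.equivFunOnFinite.symm d) := by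
    rw [sum_ite_eq']
    split_ifs with h
    · rfl
    · exact (MvPolynomial.notMem_support_iff.1 h).symm
  rw [← h2, ← sum_congr rfl h1]
  simp_rw [prod_univ_sum, mul_sum]
  rw [sum_comm]
  refine sum_congr rfl fun k _ => ?_
  rw [MvPolynomial.eval_eq', sum_div]
  refine sum_congr rfl fun e _ => ?_
  rw [prod_div_distrib, mul_div_assoc]

end Interpolation

/-! ### Adding a variable: tilings by intervals of exponents -/

section Extension

variable {K : Type*} [Field K] {q : K}

theorem pow_injective_of_forall_ne_one (hq0 : q ≠ 0) (hq : ∀ m : ℕ, 1 ≤ m → q ^ m ≠ 1) :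
    Function.Injective fun k : ℕ => q ^ k := by
  have key : ∀ a b : ℕ, a < b → q ^ a ≠ q ^ b := by
    intro a b hab h
    have hb : q ^ b = q ^ a * q ^ (b - a) := by rw [← pow_add]; congr 1; omega
    refine hq (b - a) (by omega) ?_
    rw [hb] at h
    exact (mul_right_eq_self₀.1 h.symm).resolve_right (pow_ne_zero _ hq0)
  intro a b h
  rcases lt_trichotomy a b with h' | h' | h'
  · exact absurd h (key a b h')
  · exact h'
  · exact absurd h.symm (key b a h')

/-- Where a factor evaluated at powers of `q` does not vanish, the exponents are separated. -/
theorem le_or_le_of_pairFactor_ne_zero {s t a b : ℕ}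
    (h : pairFactor q (q ^ s) (q ^ t) a b ≠ 0) : s + a ≤ t ∨ t + b + 1 ≤ s := by
  by_contra! hc
  obtain ⟨h1, h2⟩ := hc
  refine h ?_
  rcases lt_or_ge t s with hts | hts
  · refine mul_eq_zero_of_right _ (prod_eq_zero (i := s - t - 1) (by simp; omega) ?_)
    rw [← pow_add, sub_eq_zero]
    congr 1; omega
  · refine mul_eq_zero_of_left (prod_eq_zero (i := t - s) (by simp; omega) ?_) _
    rw [← pow_add, sub_eq_zero]
    congr 1; omega

/-- Disjoint intervals that fill an initial segment of `ℕ`. -/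
theorem intervals_tile {κ A : Type*} [Fintype κ] [DecidableEq κ] [CommMonoid A] (f : ℕ → A)
    {c M s : ℕ} {b k : κ → ℕ}
    (hb : ∑ j, b j = M)
    (hs : s ≤ M) (hk : ∀ j, k j + b j ≤ M + c)
    (h0 : ∀ j, s + c ≤ k j ∨ k j + b j + 1 ≤ s)
    (hdis : ∀ i j, i ≠ j → k i + b i ≤ k j ∨ k j + b j ≤ k i) :
    s = 0 ∧ (∀ j, c ≤ k j) ∧
      ∏ j, ∏ r ∈ range (b j), f (k j + r) = ∏ r ∈ range M, f (c + r) := by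
  set J : κ → Finset ℕ := fun j => Ico (k j + 1) (k j + 1 + b j) with hJ
  have hJdis : ((univ : Finset κ) : Set κ).PairwiseDisjoint J := by
    intro i _ j _ hij
    rw [Function.onFun, disjoint_left]
    intro x hx hx'
    simp only [hJ, mem_Ico] at hx hx'
    rcases hdis i j hij with h | h <;> omega
  have hU : Disjoint (Ico s (s + c + 1)) (univ.biUnion J) := by
    rw [disjoint_left]
    intro x hx hx'
    simp only [hJ, mem_Ico, mem_biUnion, mem_univ, true_and] at hx hx'
    obtain ⟨j, hj⟩ := hx'
    rcases h0 j with h | h <;> omega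
  have hsub : Ico s (s + c + 1) ∪ univ.biUnion J ⊆ range (M + c + 1) := by
    intro x hx
    simp only [hJ, mem_union, mem_Ico, mem_biUnion, mem_univ, true_and] at hx
    rw [mem_range]
    rcases hx with h | ⟨j, hj⟩
    · omega
    · have := hk j; omega
  have hcard : (univ.biUnion J).card = M := by
    rw [card_biUnion fun i hi j hj hij => hJdis hi hj hij]
    simpa [hJ] using hb
  -- The pieces have total length `(c + 1) + M`, the length of the segment that contains them, so
  -- there are no gaps.
  have heq : Ico s (s + c + 1) ∪ univ.biUnion J = range (M + c + 1) := by
    refine eq_of_subset_of_card_le hsub ?_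
    rw [card_union_of_disjoint hU, hcard]
    simp; omega
  -- The intervals `J j` start at `k j + 1 ≥ 1`, so only the interval starting at `s` can cover `0`.
  have hs0 : s = 0 := by
    have : 0 ∈ Ico s (s + c + 1) ∪ univ.biUnion J := by rw [heq]; simp
    simp only [hJ, mem_union, mem_Ico, mem_biUnion, mem_univ, true_and] at this
    rcases this with h | ⟨j, hj⟩ <;> omega
  subst hs0
  have hck : ∀ j, c ≤ k j := fun j => by rcases h0 j with h | h <;> omega
  refine ⟨rfl, hck, ?_⟩
  have hJU : univ.biUnion J = Ico (c + 1) (M + c + 1) := by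
    ext x
    have hx : x ∈ Ico 0 (0 + c + 1) ∪ univ.biUnion J ↔ x ∈ range (M + c + 1) := by rw [heq]
    have hx' : x ∈ Ico 0 (0 + c + 1) → x ∉ univ.biUnion J := fun h => disjoint_left.1 hU h
    rw [mem_union] at hx
    simp only [mem_Ico, mem_range] at hx hx' ⊢
    constructor
    · intro h
      refine ⟨?_, hx.1 (Or.inr h)⟩
      by_contra hlt
      exact hx' ⟨Nat.zero_le _, by omega⟩ h
    · rintro ⟨h1, h2⟩
      rcases hx.2 h2 with h | h
      · omega
      · exact h
  have hprod := prod_biUnion (f := fun x => f (x - 1)) hJdis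
  rw [hJU] at hprod
  have e1 : ∀ j, ∏ x ∈ J j, f (x - 1) = ∏ r ∈ range (b j), f (k j + r) := by
    intro j
    simp only [hJ]
    rw [prod_Ico_eq_prod_range]
    refine prod_congr (by congr 1; omega) fun r _ => ?_
    congr 1; omega
  simp_rw [e1] at hprod
  rw [← hprod, prod_Ico_eq_prod_range]
  refine prod_congr (by congr 1; omega) fun r _ => ?_
  congr 1; omega

theorem isHomogeneous_C_sub {σ R : Type*} [CommRing R] (u : R) (i j : σ) :
    (MvPolynomial.X i - MvPolynomial.C u * MvPolynomial.X j : MvPolynomial σ R).IsHomogeneous 1 :=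
  (MvPolynomial.isHomogeneous_X _ _).sub (MvPolynomial.isHomogeneous_C_mul_X _ _)

theorem isHomogeneous_pairFactor {σ R : Type*} [CommRing R] (q : R) (i j : σ) (a b : ℕ) :
    (pairFactor (MvPolynomial.C q) (MvPolynomial.X i) (MvPolynomial.X j) a b :
      MvPolynomial σ R).IsHomogeneous (a + b) := by
  refine MvPolynomial.IsHomogeneous.mul ?_ ?_
  · have := MvPolynomial.IsHomogeneous.prod (range a) (fun r => (MvPolynomial.X j -
      MvPolynomial.C q ^ r * MvPolynomial.X i : MvPolynomial σ R)) (fun _ => 1)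
      fun r _ => by rw [← map_pow]; exact isHomogeneous_C_sub _ _ _
    simpa using this
  · have := MvPolynomial.IsHomogeneous.prod (range b) (fun r => (MvPolynomial.X i -
      MvPolynomial.C q ^ (r + 1) * MvPolynomial.X j : MvPolynomial σ R)) (fun _ => 1)
      fun r _ => by rw [← map_pow]; exact isHomogeneous_C_sub _ _ _
    simpa using this

theorem eval_mul_of_isHomogeneous {σ R : Type*} [CommRing R] [Fintype σ] {F : MvPolynomial σ R}
    {n : ℕ} (hF : F.IsHomogeneous n) (u : R) (x : σ → R) :
    MvPolynomial.eval (fun i => u * x i) F = u ^ n * MvPolynomial.eval x F := by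
  rw [MvPolynomial.eval_eq', MvPolynomial.eval_eq', mul_sum]
  refine sum_congr rfl fun e he => ?_
  have := hF (MvPolynomial.mem_support_iff.1 he)
  rw [Finsupp.weight_apply, Finsupp.sum_fintype _ _ (by simp)] at this
  simp only [Pi.one_apply, smul_eq_mul, mul_one] at this
  simp_rw [mul_pow]
  rw [prod_mul_distrib, prod_pow_eq_pow_sum, this]
  ring

/-- Splits an interpolation denominator of the larger grid: the first `c` nodes cancel the second
product of `pairFactor` with the new variable at `1`, and the other nodes are the smaller grid
scaled by `q ^ (c + 1)`. -/
theorem prod_erase_range_add (c d k : ℕ) (hk : k ≤ d) (q : K) :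
    ∏ l ∈ (range (c + d + 1)).erase (c + k), (q ^ (c + k + 1) - q ^ (l + 1)) =
      (∏ r ∈ range c, (q ^ (c + k + 1) - q ^ (r + 1))) *
        (q ^ ((c + 1) * d) * ∏ l ∈ (range (d + 1)).erase k, (q ^ k - q ^ l)) := by
  have hset : (range (c + d + 1)).erase (c + k) =
      range c ∪ ((range (d + 1)).erase k).map (addLeftEmbedding c) := by
    ext x
    simp only [mem_erase, mem_range, mem_union, mem_map, addLeftEmbedding_apply]
    constructor
    · rintro ⟨h1, h2⟩
      rcases lt_or_ge x c with h | h
      · exact Or.inl h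
      · exact Or.inr ⟨x - c, ⟨by omega, by omega⟩, by omega⟩
    · rintro (h | ⟨y, ⟨h1, h2⟩, rfl⟩) <;> constructor <;> omega
  have hdisj : Disjoint (range c) (((range (d + 1)).erase k).map (addLeftEmbedding c)) := by
    rw [disjoint_left]
    intro x hx hx'
    simp only [mem_range, mem_map, addLeftEmbedding_apply] at hx hx'
    obtain ⟨y, -, rfl⟩ := hx'
    omega
  rw [hset, prod_union hdisj, prod_map]
  congr 1
  have hc : ((range (d + 1)).erase k).card = d := by
    rw [card_erase_of_mem (by simp; omega)]; simp
  have : q ^ ((c + 1) * d) = ∏ _l ∈ (range (d + 1)).erase k, q ^ (c + 1) := by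
    rw [prod_const, hc, pow_mul]
  rw [this, ← prod_mul_distrib]
  refine prod_congr rfl fun l _ => ?_
  simp only [addLeftEmbedding_apply]
  ring

/-- Adding one variable: if the nonvanishing of `F` at powers of `q` forces the intervals
`[k_j, k_j + b_j)` to be disjoint, the constant term with one more variable is a multiple of that
of `F`. -/
theorem coeff_mul_prod_pairFactor {κ : Type*} [Fintype κ] [DecidableEq κ]
    (hq0 : q ≠ 0) (hq : ∀ m : ℕ, 1 ≤ m → q ^ m ≠ 1) {c M : ℕ} {b d : κ → ℕ}
    {F : MvPolynomial κ K} (hF : F.IsHomogeneous (∑ j, d j))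
    (hdis : ∀ k : κ → ℕ, MvPolynomial.eval (fun j => q ^ k j) F ≠ 0 →
      ∀ i j, i ≠ j → k i + b i ≤ k j ∨ k j + b j ≤ k i)
    (hb : ∑ j, b j = M) (hdb : ∀ j, d j + b j ≤ M) :
    (MvPolynomial.rename some F * ∏ j, pairFactor (MvPolynomial.C q) (MvPolynomial.X (some j))
      (MvPolynomial.X none) (b j) c).coeff
        (Finsupp.equivFunOnFinite.symm fun o : Option κ => o.elim M fun j => c + d j) *
      ∏ r ∈ range M, (1 - q ^ (r + 1)) =
    (∏ r ∈ range M, (1 - q ^ (c + r + 1))) * F.coeff (Finsupp.equivFunOnFinite.symm d) := by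
  have hinj := pow_injective_of_forall_ne_one hq0 hq
  have hne : ∀ m : ℕ, (1 : K) - q ^ (m + 1) ≠ 0 := fun m h =>
    hq (m + 1) (by omega) (sub_eq_zero.1 h).symm
  have hhom : (MvPolynomial.rename some F * ∏ j, pairFactor (MvPolynomial.C q)
      (MvPolynomial.X (some j)) (MvPolynomial.X none) (b j) c : MvPolynomial (Option κ) K
      ).IsHomogeneous (∑ o : Option κ, o.elim M fun j => c + d j) := by
    have h1 := (hF.rename_isHomogeneous (f := some)).mul
      (MvPolynomial.IsHomogeneous.prod univ (fun j => (pairFactor (MvPolynomial.C q)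
        (MvPolynomial.X (some j)) (MvPolynomial.X none) (b j) c : MvPolynomial (Option κ) K))
        (fun j => b j + c) fun j _ => isHomogeneous_pairFactor _ _ _ _ _)
    convert h1 using 1
    rw [Fintype.sum_option]
    simp only [Option.elim_none, Option.elim_some, sum_add_distrib, hb]
    ring
  rw [coeff_eq_sum_piFinset (f := F) (d := d) (v := fun _ l => q ^ l)
    (fun i => hinj.injOn) hF]
  -- The old variables use nodes `q ^ (l + 1)` and the new one `q ^ l`, so that the exponent `0` is
  -- available to the new variable only.
  rw [coeff_eq_sum_piFinset (v := fun o l => o.elim (q ^ l) fun _ => q ^ (l + 1)) ?_ hhom]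
  swap
  · rintro (_ | j)
    · exact hinj.injOn
    · intro x _ y _ h
      exact Nat.succ_injective (hinj h)
  rw [sum_mul, mul_sum]
  symm
  -- A term of the smaller sum goes to the one with the new variable at `q ^ 0` and the old
  -- exponents raised by `c + 1`: `c` in the index and `1` in the node. Terms outside the image
  -- vanish by the tiling.
  refine sum_of_injOn (fun k o => o.elim 0 fun j => c + k j) ?_ ?_ ?_ ?_
  · intro k _ k' _ h
    funext j
    have := congrFun h (some j)
    simpa using this
  · intro k hk
    simp only [Fintype.coe_piFinset, Set.mem_pi, Set.mem_univ, forall_const, coe_range,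
      Set.mem_Iio] at hk ⊢
    rintro (_ | j)
    · simp
    · have := hk j
      simp only [Option.elim_some]; omega
  · intro k hk hk'
    simp only [Fintype.mem_piFinset, mem_range] at hk
    by_contra hne0
    have hev : MvPolynomial.eval (fun o : Option κ => o.elim (q ^ k o) fun _ => q ^ (k o + 1))
      (MvPolynomial.rename some F * ∏ j, pairFactor (MvPolynomial.C q)
      (MvPolynomial.X (some j)) (MvPolynomial.X none) (b j) c) ≠ 0 := by
      intro h
      rw [h] at hne0
      simp at hne0
    rw [map_mul, map_prod] at hev
    have hevF := left_ne_zero_of_mul hev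
    have hevP := prod_ne_zero_iff.1 (right_ne_zero_of_mul hev)
    rw [MvPolynomial.eval_rename] at hevF
    have hF' := hdis (fun j => k (some j) + 1) (by simpa [Function.comp_def] using hevF)
    have h0 : ∀ j, k none + c ≤ k (some j) ∨ k (some j) + b j + 1 ≤ k none := by
      intro j
      have := hevP j (mem_univ j)
      rw [map_pairFactor] at this
      simp only [MvPolynomial.eval_C, MvPolynomial.eval_X, Option.elim_some,
        Option.elim_none] at this
      rcases le_or_le_of_pairFactor_ne_zero this with h | h
      · right; omega
      · left; omega
    have hkn := hk none
    have hks := fun j => hk (some j)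
    simp only [Option.elim_none, Option.elim_some] at hkn hks
    obtain ⟨hs, hck, -⟩ := intervals_tile (fun _ => (1 : ℕ)) (c := c)
      (k := fun j => k (some j)) hb (by omega)
      (fun j => by have := hks j; have := hdb j; omega) h0
      (fun i j hij => by have := hF' i j hij; omega)
    refine hk' ⟨fun j => k (some j) - c, ?_, ?_⟩
    · simp only [Fintype.coe_piFinset, Set.mem_pi, Set.mem_univ, forall_const, coe_range,
        Set.mem_Iio]
      intro j
      have := hks j
      have := hck j
      omega
    · funext o
      rcases o with _ | j
      · simpa using hs.symm
      · have := hck j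
        simp only [Option.elim_some]; omega
  · intro k hk
    simp only [Fintype.mem_piFinset, mem_range] at hk
    rw [map_mul, map_prod, MvPolynomial.eval_rename, Fintype.prod_option]
    simp only [Function.comp_def, Option.elim_some, Option.elim_none, map_pairFactor,
      MvPolynomial.eval_C, MvPolynomial.eval_X, pow_zero]
    have hshift : MvPolynomial.eval (fun j => q ^ (c + k j + 1)) F =
        q ^ ((c + 1) * ∑ j, d j) * MvPolynomial.eval (fun j => q ^ k j) F := by
      rw [pow_mul, ← eval_mul_of_isHomogeneous hF]
      congr 2
      funext j
      ring
    rw [hshift]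
    have hden : ∏ j, ∏ l ∈ (range (c + d j + 1)).erase (c + k j), (q ^ (c + k j + 1) - q ^ (l + 1)) =
        (∏ j, ∏ r ∈ range c, (q ^ (c + k j + 1) - q ^ (r + 1))) * (q ^ ((c + 1) * ∑ j, d j) *
          ∏ j, ∏ l ∈ (range (d j + 1)).erase (k j), (q ^ k j - q ^ l)) := by
      rw [mul_sum, ← prod_pow_eq_pow_sum, ← prod_mul_distrib, ← prod_mul_distrib]
      exact prod_congr rfl fun j _ => prod_erase_range_add _ _ _ (by have := hk j; omega) _
    rw [hden]
    have hden0 : ∏ l ∈ (range (M + 1)).erase 0, ((1 : K) - q ^ l) =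
        ∏ r ∈ range M, (1 - q ^ (r + 1)) := by
      have : (range (M + 1)).erase 0 = (range M).map (addRightEmbedding 1) := by
        ext x
        simp only [mem_erase, mem_range, mem_map, addRightEmbedding_apply]
        constructor
        · rintro ⟨h1, h2⟩
          exact ⟨x - 1, by omega, by omega⟩
        · rintro ⟨y, h1, rfl⟩
          omega
      rw [this, prod_map]
      rfl
    rw [hden0]
    simp only [pairFactor, prod_mul_distrib]
    rcases eq_or_ne (MvPolynomial.eval (fun j => q ^ k j) F) 0 with hz | hz
    · simp [hz]
    have hF' := hdis (fun j => c + k j) (by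
      have := eval_mul_of_isHomogeneous hF (q ^ c) (fun j => q ^ k j)
      simp_rw [← pow_add] at this
      rw [this]
      exact mul_ne_zero (pow_ne_zero _ (pow_ne_zero _ hq0)) hz)
    -- For a nonzero term the tiling evaluates the product of the factors `1 - q ^ r * x_j`, and the
    -- result does not depend on `k`.
    obtain ⟨-, -, htile⟩ := intervals_tile (fun x => 1 - q ^ (x + 1)) (c := c) (s := 0)
      (k := fun j => c + k j) hb (by omega)
      (fun j => by have := hk j; have := hdb j; omega) (fun j => by left; omega) hF'
    have e1 : ∏ j, ∏ r ∈ range (b j), (1 - q ^ r * q ^ (c + k j + 1)) =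
        ∏ r ∈ range M, (1 - q ^ (c + r + 1)) := by
      rw [← htile]
      refine prod_congr rfl fun j _ => prod_congr rfl fun r _ => ?_
      ring
    rw [e1]
    have hA : ∏ j, ∏ r ∈ range c, (q ^ (c + k j + 1) - q ^ (r + 1)) ≠ 0 := by
      refine prod_ne_zero_iff.2 fun j _ => prod_ne_zero_iff.2 fun r hr => ?_
      rw [sub_ne_zero]
      intro h
      have := hinj h
      rw [mem_range] at hr
      omega
    have hB : ∏ r ∈ range M, ((1 : K) - q ^ (r + 1)) ≠ 0 := prod_ne_zero_iff.2 fun r _ => hne r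
    have hC : ∏ j, ∏ l ∈ (range (d j + 1)).erase (k j), (q ^ k j - q ^ l) ≠ 0 := by
      refine prod_ne_zero_iff.2 fun j _ => prod_ne_zero_iff.2 fun r hr => ?_
      rw [sub_ne_zero]
      intro h
      exact (mem_erase.1 hr).1 (hinj h).symm
    have hQ : q ^ ((c + 1) * ∑ j, d j) ≠ 0 := pow_ne_zero _ hq0
    simp only [mul_one]
    field_simp

end Extension

/-! ### Antisymmetric functionals and the product `∏ (x_i - t x_o)` -/

section Antisymmetric

variable {ι K : Type*} [Field K] {n : ℕ} {y : ℕ → ι} {o : ι}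

/-- The auxiliary products in the expansion of `∏ v, (y_v - t o)` against `∏ v, y_v ^ v`. -/
def staircase {ι : Type*} (K : Type*) [Field K] (n : ℕ) (y : ℕ → ι) (o : ι) (t : K) (r s : ℕ) :
    MvPolynomial ι K :=
  (∏ v ∈ range n, MvPolynomial.X (y v) ^ (v + if r + s ≤ v then 1 else 0)) *
    MvPolynomial.X o ^ s *
      ∏ v ∈ range r, (MvPolynomial.X (y v) - MvPolynomial.C t * MvPolynomial.X o)

theorem X_mul_prod_pow {a : ℕ} (ha : a < n) (g : ℕ → ℕ) :
    MvPolynomial.X (y a) * ∏ v ∈ range n, (MvPolynomial.X (y v) : MvPolynomial ι K) ^ g v =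
      ∏ v ∈ range n, MvPolynomial.X (y v) ^ (g v + if v = a then 1 else 0) := by
  simp_rw [pow_add]
  have h : ∏ v ∈ range n, (MvPolynomial.X (y v) : MvPolynomial ι K) ^ (if v = a then 1 else 0) =
      MvPolynomial.X (y a) := by
    simp [pow_ite, ha]
  rw [prod_mul_distrib, h]
  ring

/-- Expands the factor `y_r - t o`: its first term raises the exponent of `y_r` from `r` to `r + 1`,
its second contributes one power of `o`. -/
theorem staircase_succ_zero {r : ℕ} (hr : r < n) (t : K) :
    staircase K n y o t (r + 1) 0 =
      staircase K n y o t r 0 - MvPolynomial.C t * staircase K n y o t r 1 := by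
  have h : ∏ v ∈ range n, (MvPolynomial.X (y v) : MvPolynomial ι K) ^
      (v + if r ≤ v then 1 else 0) = MvPolynomial.X (y r) *
      ∏ v ∈ range n, MvPolynomial.X (y v) ^ (v + if r + 1 ≤ v then 1 else 0) := by
    rw [X_mul_prod_pow hr]
    refine prod_congr rfl fun v _ => ?_
    congr 1
    split_ifs <;> omega
  simp only [staircase, add_zero, prod_range_succ, h]
  ring

variable [DecidableEq ι]

/-- A linear functional that changes sign under the transpositions of variables in `S`. -/
def IsAntisymmOn (A : MvPolynomial ι K →ₗ[K] K) (S : Set ι) : Prop :=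
  ∀ u ∈ S, ∀ v ∈ S, u ≠ v → ∀ f, A (MvPolynomial.rename (Equiv.swap u v) f) = -A f

theorem IsAntisymmOn.eq_zero [CharZero K] {A : MvPolynomial ι K →ₗ[K] K} {S : Set ι}
    (hA : IsAntisymmOn A S) {u v : ι} (hu : u ∈ S) (hv : v ∈ S) (huv : u ≠ v)
    {f : MvPolynomial ι K} (hf : MvPolynomial.rename (Equiv.swap u v) f = f) : A f = 0 := by
  have := hA u hu v hv huv f
  rw [hf] at this
  exact self_eq_neg.1 this

theorem rename_swap_prod (hy : Set.InjOn y (range n)) {a b : ℕ} (ha : a < n) (hb : b < n)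
    (g : ℕ → ℕ) :
    MvPolynomial.rename (Equiv.swap (y a) (y b))
      (∏ v ∈ range n, (MvPolynomial.X (y v) : MvPolynomial ι K) ^ g v) =
    ∏ v ∈ range n, MvPolynomial.X (y v) ^ g (Equiv.swap a b v) := by
  have hmem : ∀ v ∈ range n, Equiv.swap a b v ∈ range n := by
    intro v hv
    rw [mem_range] at *
    rw [Equiv.swap_apply_def]
    split_ifs <;> assumption
  have hsw : ∀ v ∈ range n, Equiv.swap (y a) (y b) (y v) = y (Equiv.swap a b v) := by
    intro v hv
    have e : ∀ c, c < n → (y v = y c ↔ v = c) := fun c hc =>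
      ⟨fun h => hy hv (by simpa using hc) h, fun h => by rw [h]⟩
    simp only [Equiv.swap_apply_def, e a ha, e b hb]
    split_ifs <;> rfl
  simp only [map_prod, map_pow, MvPolynomial.rename_X]
  refine prod_nbij' (Equiv.swap a b) (Equiv.swap a b) hmem hmem (by simp) (by simp) ?_
  intro v hv
  rw [hsw v hv, Equiv.swap_apply_self]

/-- The two monomials differ by the transposition of `y_s` and `o`, whose exponents are `s + 1` and
`s`. -/
theorem map_staircase_zero_succ {A : MvPolynomial ι K →ₗ[K] K} {S : Set ι}
    (hA : IsAntisymmOn A S) (hy : Set.InjOn y (range n))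
    (hyS : ∀ v < n, y v ∈ S) (hoS : o ∈ S) (ho : ∀ v < n, y v ≠ o) (t : K) {s : ℕ} (hs : s < n) :
    A (staircase K n y o t 0 (s + 1)) = -A (staircase K n y o t 0 s) := by
  rw [← hA (y s) (hyS s hs) o hoS (ho s hs)]
  congr 1
  simp only [staircase, zero_add, range_zero, prod_empty, mul_one, map_mul, map_pow, map_prod,
    MvPolynomial.rename_X, Equiv.swap_apply_right]
  rw [← mul_prod_erase _ _ (mem_range.2 hs), ← mul_prod_erase _ _ (mem_range.2 hs)]
  have h : ∏ v ∈ (range n).erase s, (MvPolynomial.X (Equiv.swap (y s) o (y v)) :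
      MvPolynomial ι K) ^ (v + if s ≤ v then 1 else 0) =
      ∏ v ∈ (range n).erase s, MvPolynomial.X (y v) ^ (v + if s + 1 ≤ v then 1 else 0) := by
    refine prod_congr rfl fun v hv => ?_
    rw [mem_erase, mem_range] at hv
    rw [Equiv.swap_apply_of_ne_of_ne _ (ho v hv.2)]
    · congr 1
      have := hv.1
      split_ifs <;> omega
    · exact fun h => hv.1 (hy (by simpa using hv.2) (by simpa using hs) h)
  rw [h]
  simp only [Equiv.swap_apply_left, le_refl, if_true, Nat.not_succ_le_self, if_false, add_zero]
  ring

section Functional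

variable [CharZero K] {A : MvPolynomial ι K →ₗ[K] K} {S : Set ι}

/-- When `s ≥ 1`, the `y_r` term of the factor `y_r - t o` gives both `y_r` and `y_(r+1)` the
exponent `r + 1`. It is symmetric in these two variables, so `A` kills it and only the `-t o` term
survives. -/
theorem map_staircase_succ (hA : IsAntisymmOn A S) (hy : Set.InjOn y (range n))
    (hyS : ∀ v < n, y v ∈ S) (ho : ∀ v < n, y v ≠ o) (t : K) {r s : ℕ}
    (hs : 1 ≤ s) (hrs : r + 1 + s ≤ n) :
    A (staircase K n y o t (r + 1) s) = -t * A (staircase K n y o t r (s + 1)) := by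
  set g : ℕ → ℕ := fun v => v + (if r + 1 + s ≤ v then 1 else 0) + if v = r then 1 else 0 with hg
  set W : MvPolynomial ι K := (∏ v ∈ range n, MvPolynomial.X (y v) ^ g v) *
    MvPolynomial.X o ^ s *
      ∏ v ∈ range r, (MvPolynomial.X (y v) - MvPolynomial.C t * MvPolynomial.X o) with hW
  have hdecomp : staircase K n y o t (r + 1) s = W - t • staircase K n y o t r (s + 1) := by
    rw [hW, hg, ← X_mul_prod_pow (by omega : r < n), MvPolynomial.smul_eq_C_mul]
    have e : r + (s + 1) = r + 1 + s := by ring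
    simp only [staircase, prod_range_succ, e]
    ring
  have hW0 : A W = 0 := by
    have hne : y r ≠ y (r + 1) := fun h => by
      have := hy (by simp; omega) (by simp; omega) h
      omega
    refine hA.eq_zero (hyS r (by omega)) (hyS (r + 1) (by omega)) hne ?_
    rw [hW, map_mul, map_mul, rename_swap_prod hy (by omega) (by omega)]
    congr 1
    · congr 1
      · refine prod_congr rfl fun v _ => ?_
        congr 1
        simp only [hg]
        rw [Equiv.swap_apply_def]
        split_ifs <;> omega
      · rw [map_pow, MvPolynomial.rename_X, Equiv.swap_apply_of_ne_of_ne]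
        · exact (ho r (by omega)).symm
        · exact (ho (r + 1) (by omega)).symm
    · rw [map_prod]
      refine prod_congr rfl fun v hv => ?_
      rw [mem_range] at hv
      rw [map_sub, map_mul, MvPolynomial.rename_X, MvPolynomial.rename_X, MvPolynomial.rename_C,
        Equiv.swap_apply_of_ne_of_ne (ho r (by omega)).symm (ho (r + 1) (by omega)).symm,
        Equiv.swap_apply_of_ne_of_ne]
      · intro h
        have := hy (by simp; omega) (by simp; omega) h
        omega
      · intro h
        have := hy (by simp; omega) (by simp; omega) h
        omega
  rw [hdecomp, map_sub, map_smul, hW0, smul_eq_mul]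
  ring

/-- Each step from `r` to `r + 1` at `s = 0` adds `-t A(r, 1)`. Moving down to `r = 0` gives `A(r,
1) = (-t) ^ r A(0, r + 1)`, which is `-t ^ r A(0, 0)`, so the step adds `t ^ (r + 1) A(0, 0)`. -/
theorem map_staircase (hA : IsAntisymmOn A S) (hy : Set.InjOn y (range n))
    (hyS : ∀ v < n, y v ∈ S) (hoS : o ∈ S) (ho : ∀ v < n, y v ≠ o) (t : K) (r : ℕ) (hr : r ≤ n) :
    A (staircase K n y o t r 0) = (∑ i ∈ range (r + 1), t ^ i) * A (staircase K n y o t 0 0) := by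
  have h1 : ∀ s ≤ n, A (staircase K n y o t 0 s) = (-1) ^ s * A (staircase K n y o t 0 0) := by
    intro s
    induction s with
    | zero => simp
    | succ s ih =>
      intro hs
      rw [map_staircase_zero_succ hA hy hyS hoS ho t (by omega), ih (by omega)]
      ring
  have h2 : ∀ r s, 1 ≤ s → r + s ≤ n →
      A (staircase K n y o t r s) = (-t) ^ r * A (staircase K n y o t 0 (r + s)) := by
    intro r
    induction r with
    | zero => intro s _ _; simp
    | succ r ih =>
      intro s hs hrs
      rw [map_staircase_succ hA hy hyS ho t hs hrs, ih (s + 1) (by omega) (by omega)]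
      rw [show r + (s + 1) = r + 1 + s by ring]
      ring
  induction r with
  | zero => simp
  | succ r ih =>
    rw [staircase_succ_zero (by omega), ← MvPolynomial.smul_eq_C_mul, map_sub, map_smul,
      ih (by omega), h2 r 1 le_rfl (by omega), h1 (r + 1) hr, sum_range_succ _ (r + 1), smul_eq_mul]
    have : (-t) ^ r * (-1) ^ (r + 1) = -t ^ r := by
      rw [neg_pow, pow_succ, show (-1 : K) ^ r * t ^ r * ((-1) ^ r * -1) =
        -(((-1) * (-1)) ^ r * t ^ r) by rw [mul_pow]; ring]
      simp
    linear_combination (-t * A (staircase K n y o t 0 0)) * this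

/-- Symmetrization of a monomial times `∏ i, (φ_i - t o)`. -/
theorem map_monomial_mul_prod_sub (hA : IsAntisymmOn A S) {φ : Fin n → ι}
    (hφ : Function.Injective φ) (hφS : ∀ i, φ i ∈ S) (hoS : o ∈ S) (ho : ∀ i, φ i ≠ o) (t : K)
    (α : Fin n → ℕ) (hα : ∀ i, α i < n) :
    A ((∏ i, MvPolynomial.X (φ i) ^ α i) *
        ∏ i, (MvPolynomial.X (φ i) - MvPolynomial.C t * MvPolynomial.X o)) =
      (∑ i ∈ range (n + 1), t ^ i) *
        A ((∏ i, MvPolynomial.X (φ i) ^ α i) * ∏ i, MvPolynomial.X (φ i)) := by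
  by_cases hinj : Function.Injective α
  -- Distinct exponents below `n` form a permutation of `0, …, n - 1`; listing the variables by
  -- exponent gives the staircase.
  · let σ : Equiv.Perm (Fin n) := Equiv.ofBijective (fun i => ⟨α i, hα i⟩)
      (Finite.injective_iff_bijective.1 fun i j h => hinj (by simpa using h))
    let y : ℕ → ι := fun v => if h : v < n then φ (σ.symm ⟨v, h⟩) else o
    have hyv : ∀ i : Fin n, y i = φ (σ.symm i) := fun i => by simp [y]
    have hyS : ∀ v < n, y v ∈ S := fun v hv => by simpa [y, hv] using hφS _
    have hyo : ∀ v < n, y v ≠ o := fun v hv => by simpa [y, hv] using ho _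
    have hyinj : Set.InjOn y (range n) := by
      intro a ha b hb hab
      simp only [coe_range, Set.mem_Iio] at ha hb
      simp only [y, ha, hb, dif_pos] at hab
      simpa using hφ hab
    have key := map_staircase hA hyinj hyS hoS hyo t n le_rfl
    have e : ∀ g : ℕ → ι → MvPolynomial ι K,
        ∏ v ∈ range n, g v (y v) = ∏ i, g (α i) (φ i) := by
      intro g
      rw [prod_range, ← Equiv.prod_comp σ]
      refine prod_congr rfl fun i _ => ?_
      rw [hyv, Equiv.symm_apply_apply]
      rfl
    have e1 : staircase K n y o t n 0 = (∏ i, MvPolynomial.X (φ i) ^ α i) *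
        ∏ i, (MvPolynomial.X (φ i) - MvPolynomial.C t * MvPolynomial.X o) := by
      simp only [staircase, add_zero, pow_zero, mul_one]
      rw [e fun v i => MvPolynomial.X i ^ (v + if n ≤ v then 1 else 0),
        e fun _ i => MvPolynomial.X i - MvPolynomial.C t * MvPolynomial.X o]
      congr 1
      refine prod_congr rfl fun i _ => ?_
      rw [if_neg (not_le.2 (hα i)), add_zero]
    have e0 : staircase K n y o t 0 0 = (∏ i, MvPolynomial.X (φ i) ^ α i) *
        ∏ i, MvPolynomial.X (φ i) := by
      simp only [staircase, add_zero, pow_zero, mul_one, range_zero, prod_empty, zero_le, if_true]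
      rw [e fun v i => MvPolynomial.X i ^ (v + 1), ← prod_mul_distrib]
      exact prod_congr rfl fun i _ => pow_succ _ _
    rw [← e1, ← e0, key]
  -- Two equal exponents make both arguments of `A` symmetric in those variables, so both sides
  -- vanish.
  · rw [Function.Injective] at hinj
    push Not at hinj
    obtain ⟨i, j, hij, hne⟩ := hinj
    have hsw : ∀ k, Equiv.swap (φ i) (φ j) (φ k) = φ (Equiv.swap i j k) :=
      fun k => (hφ.swap_apply i j k)
    have hαsw : ∀ k, α (Equiv.swap i j k) = α k := by
      intro k
      rw [Equiv.swap_apply_def]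
      split_ifs with h1 h2
      · rw [h1, hij]
      · rw [h2, hij]
      · rfl
    have hosw : Equiv.swap (φ i) (φ j) o = o :=
      Equiv.swap_apply_of_ne_of_ne (ho i).symm (ho j).symm
    have h1 : ∀ g : ι → MvPolynomial ι K,
        (∀ k, MvPolynomial.rename (Equiv.swap (φ i) (φ j)) (g (φ k)) =
          g (φ (Equiv.swap i j k))) →
        A ((∏ i, MvPolynomial.X (φ i) ^ α i) * ∏ i, g (φ i)) = 0 := by
      intro g hg
      refine hA.eq_zero (hφS i) (hφS j) (hφ.ne hne) ?_
      rw [map_mul, map_prod, map_prod]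
      congr 1
      · simp only [map_pow, MvPolynomial.rename_X, hsw]
        rw [← Equiv.prod_comp (Equiv.swap i j) fun k => (MvPolynomial.X (φ k) :
          MvPolynomial ι K) ^ α k]
        exact prod_congr rfl fun k _ => by rw [hαsw]
      · simp only [hg]
        exact Equiv.prod_comp (Equiv.swap i j) fun k => g (φ k)
    rw [h1 (fun i => MvPolynomial.X i - MvPolynomial.C t * MvPolynomial.X o),
      h1 (fun i => MvPolynomial.X i), mul_zero]
    · intro k; simp [hsw]
    · intro k; simp [hsw, hosw]

theorem map_rename_mul_prod_sub (hA : IsAntisymmOn A S) {φ : Fin n → ι}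
    (hφ : Function.Injective φ) (hφS : ∀ i, φ i ∈ S) (hoS : o ∈ S) (ho : ∀ i, φ i ≠ o) (t : K)
    (T : MvPolynomial (Fin n) K) (hT : ∀ e ∈ T.support, ∀ i, e i < n) :
    A (MvPolynomial.rename φ T *
        ∏ i, (MvPolynomial.X (φ i) - MvPolynomial.C t * MvPolynomial.X o)) =
      (∑ i ∈ range (n + 1), t ^ i) *
        A (MvPolynomial.rename φ T * ∏ i, MvPolynomial.X (φ i)) := by
  have hmono : MvPolynomial.rename φ T =
      ∑ e ∈ T.support, T.coeff e • ∏ i, (MvPolynomial.X (φ i) : MvPolynomial ι K) ^ e i := by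
    conv_lhs => rw [T.as_sum]
    rw [map_sum]
    refine sum_congr rfl fun e _ => ?_
    rw [MvPolynomial.monomial_eq, map_mul, MvPolynomial.rename_C, MvPolynomial.smul_eq_C_mul,
      Finsupp.prod_fintype _ _ (by simp)]
    simp
  obtain ⟨Q, hQ⟩ : ∃ Q, Q = ∑ i ∈ range (n + 1), t ^ i := ⟨_, rfl⟩
  rw [← hQ]
  simp only [hmono, sum_mul, map_sum, smul_mul_assoc, map_smul]
  rw [mul_sum]
  refine sum_congr rfl fun e he => ?_
  rw [map_monomial_mul_prod_sub hA hφ hφS hoS ho t (fun i => e i) (hT e he), ← hQ,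
    smul_eq_mul, smul_eq_mul]
  ring

end Functional

/-- Each variable occurs in `n - 1` linear factors. This is the exponent bound that
`map_rename_mul_prod_sub` requires. -/
theorem support_prod_sub_lt (t : K) (e : Fin n →₀ ℕ)
    (he : e ∈ (∏ i : Fin n, ∏ j ∈ Ioi i, (MvPolynomial.X i - MvPolynomial.C t * MvPolynomial.X j :
      MvPolynomial (Fin n) K)).support) (v : Fin n) : e v < n := by
  have h1 : e v ≤ MvPolynomial.degreeOf v (∏ i : Fin n, ∏ j ∈ Ioi i,
      (MvPolynomial.X i - MvPolynomial.C t * MvPolynomial.X j : MvPolynomial (Fin n) K)) :=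
    MvPolynomial.monomial_le_degreeOf v he
  have h2 : MvPolynomial.degreeOf v (∏ i : Fin n, ∏ j ∈ Ioi i,
      (MvPolynomial.X i - MvPolynomial.C t * MvPolynomial.X j : MvPolynomial (Fin n) K)) ≤
      ∑ i : Fin n, ∑ j ∈ Ioi i, ((if i = v then 1 else 0) + if j = v then 1 else 0) := by
    refine (MvPolynomial.degreeOf_prod_le _ _ _).trans (sum_le_sum fun i _ => ?_)
    refine (MvPolynomial.degreeOf_prod_le _ _ _).trans (sum_le_sum fun j _ => ?_)
    refine (MvPolynomial.degreeOf_sub_le _ _ _).trans (max_le ?_ ?_)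
    · rw [MvPolynomial.degreeOf_X, if_congr (eq_comm (a := v)) rfl rfl]
      exact Nat.le_add_right _ _
    · refine (MvPolynomial.degreeOf_C_mul_le _ _ _).trans ?_
      rw [MvPolynomial.degreeOf_X, if_congr (eq_comm (a := v)) rfl rfl]
      exact Nat.le_add_left _ _
  have h3 : ∑ i : Fin n, ∑ j ∈ Ioi i, ((if i = v then 1 else 0) + if j = v then 1 else 0) =
      n - 1 := by
    simp only [sum_add_distrib, sum_ite_eq', mem_Ioi]
    have : ∑ i : Fin n, ∑ _j ∈ Ioi i, (if i = v then 1 else 0) = n - 1 - v := by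
      simp [sum_const]
    rw [this]
    have : ∑ i : Fin n, (if i < v then 1 else 0) = (v : ℕ) := by
      rw [sum_boole]
      have : (univ.filter fun i => i < v) = Iio v := by ext; simp
      rw [this]; simp
    rw [this]
    have := v.2
    omega
  have := v.2
  omega

end Antisymmetric

/-! ### The polynomial form of the constant term -/

section Polynomial

variable {R : Type*} [CommRing R]

/-- The polynomial form of the constant term problem: `w` variables with pair exponents `e`,
followed by a block of `m` variables. -/
def ctPoly (q : R) (c w m : ℕ) (e : Fin w → Fin w → ℕ) : MvPolynomial (Fin w ⊕ Fin m) R :=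
  (∏ i, ∏ j ∈ Ioi i, pairFactor (MvPolynomial.C q) (MvPolynomial.X (Sum.inl i))
    (MvPolynomial.X (Sum.inl j)) (e i j) (e i j)) *
  ((∏ i : Fin w, ∏ j : Fin m, pairFactor (MvPolynomial.C q) (MvPolynomial.X (Sum.inl i))
    (MvPolynomial.X (Sum.inr j)) c c) *
  ∏ i : Fin m, ∏ j ∈ Ioi i, pairFactor (MvPolynomial.C q) (MvPolynomial.X (Sum.inr i))
    (MvPolynomial.X (Sum.inr j)) (c + 1) (c + 1))

/-- The exponent vector of the monomial of `ctPoly` that corresponds to the constant term. -/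
def ctWeight (c w m : ℕ) (e : Fin w → Fin w → ℕ) : (Fin w ⊕ Fin m) →₀ ℕ :=
  (∑ i, ∑ j ∈ Ioi i, e i j • (Finsupp.single (Sum.inl i) 1 + Finsupp.single (Sum.inl j) 1)) +
  ((∑ i : Fin w, ∑ j : Fin m,
    c • (Finsupp.single (Sum.inl i) 1 + Finsupp.single (Sum.inr j) 1)) +
  ∑ i : Fin m, ∑ j ∈ Ioi i,
    (c + 1) • (Finsupp.single (Sum.inr i) 1 + Finsupp.single (Sum.inr j) 1))

/-- The constant term of `ctPoly`. -/
def ctCoeff (q : R) (c w m : ℕ) (e : Fin w → Fin w → ℕ) : R :=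
  (ctPoly q c w m e).coeff (ctWeight c w m e)

/-- Lets the recursion pass from `ℤ[X]` into its fraction field and down to any ring. -/
theorem map_ctCoeff {S : Type*} [CommRing S] (f : R →+* S) (q : R) (c w m : ℕ)
    (e : Fin w → Fin w → ℕ) : f (ctCoeff q c w m e) = ctCoeff (f q) c w m e := by
  rw [ctCoeff, ctCoeff, ← MvPolynomial.coeff_map]
  simp [ctPoly, map_pairFactor]

theorem sum_sum_Ioi_single {w : ℕ} (e : Fin w → Fin w → ℕ) (v : Fin w) :
    ∑ i, ∑ j ∈ Ioi i, e i j * ((if i = v then 1 else 0) + if j = v then 1 else 0) =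
      ∑ j ∈ Ioi v, e v j + ∑ j ∈ Iio v, e j v := by
  simp only [mul_add, sum_add_distrib, mul_ite, mul_one, mul_zero, sum_ite_eq', mem_Ioi]
  congr 1
  · rw [sum_eq_single v]
    · simp
    · intro i _ hi
      simp [hi]
    · simp
  · rw [← sum_filter]
    congr 1
    ext; simp

theorem ctWeight_inl (c w m : ℕ) (e : Fin w → Fin w → ℕ) (v : Fin w) :
    ctWeight c w m e (Sum.inl v) = ∑ j ∈ Ioi v, e v j + ∑ j ∈ Iio v, e j v + m * c := by
  simp only [ctWeight, Finsupp.add_apply, Finsupp.finsetSum_apply, Finsupp.smul_apply,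
    Finsupp.single_apply, Sum.inl.injEq, smul_eq_mul, sum_sum_Ioi_single, reduceCtorEq, if_false,
    add_zero, mul_zero, sum_const_zero]
  simp [mul_comm]

theorem ctWeight_inr (c w m : ℕ) (e : Fin w → Fin w → ℕ) (v : Fin m) :
    ctWeight c w m e (Sum.inr v) = w * c + (m - 1) * (c + 1) := by
  simp only [ctWeight, Finsupp.add_apply, Finsupp.finsetSum_apply, Finsupp.smul_apply,
    Finsupp.single_apply, Sum.inr.injEq, smul_eq_mul, reduceCtorEq, if_false,
    add_zero, zero_add, mul_zero, sum_const_zero]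
  rw [sum_sum_Ioi_single (fun _ _ => c + 1) v]
  have := v.2
  simp only [sum_const, Fin.card_Ioi, Fin.card_Iio, smul_eq_mul, ← add_mul]
  rw [show m - 1 - v + v = m - 1 by omega]
  simp

theorem isHomogeneous_ctPoly (q : R) (c w m : ℕ) (e : Fin w → Fin w → ℕ) :
    (ctPoly q c w m e).IsHomogeneous (∑ v, ctWeight c w m e v) := by
  have h : ∑ v, ctWeight c w m e v = (∑ i, ∑ j ∈ Ioi i, (e i j + e i j)) +
      ((∑ _i : Fin w, ∑ _j : Fin m, (c + c)) + ∑ i : Fin m, ∑ _j ∈ Ioi i, (c + 1 + (c + 1))) := by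
    have : ∑ v, ctWeight c w m e v = (ctWeight c w m e).degree := (Finsupp.degree_eq_sum _).symm
    rw [this, ctWeight]
    simp only [map_add, map_sum, map_nsmul, Finsupp.degree_single, smul_eq_mul, mul_add, mul_one]
  rw [h]
  refine MvPolynomial.IsHomogeneous.mul ?_ (MvPolynomial.IsHomogeneous.mul ?_ ?_)
  · exact MvPolynomial.IsHomogeneous.prod _ _ _ fun i _ =>
      MvPolynomial.IsHomogeneous.prod _ _ _ fun j _ => isHomogeneous_pairFactor _ _ _ _ _
  · exact MvPolynomial.IsHomogeneous.prod _ _ _ fun i _ =>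
      MvPolynomial.IsHomogeneous.prod _ _ _ fun j _ => isHomogeneous_pairFactor _ _ _ _ _
  · exact MvPolynomial.IsHomogeneous.prod _ _ _ fun i _ =>
      MvPolynomial.IsHomogeneous.prod _ _ _ fun j _ => isHomogeneous_pairFactor _ _ _ _ _

/-- The variables before the last variable of the block, and that last variable. -/
def addLast {w m : ℕ} (o : Option (Fin w ⊕ Fin m)) : Fin w ⊕ Fin (m + 1) :=
  o.elim (Sum.inr (Fin.last m)) (Sum.map id Fin.castSucc)

theorem addLast_injective {w m : ℕ} : Function.Injective (addLast (w := w) (m := m)) := by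
  rintro (_ | i | i) (_ | j | j) h <;> simp_all [addLast, Fin.castSucc_ne_last, eq_comm]

theorem addLast_surjective {w m : ℕ} : Function.Surjective (addLast (w := w) (m := m)) := by
  rintro (i | i)
  · exact ⟨some (Sum.inl i), rfl⟩
  · induction i using Fin.lastCases with
    | last => exact ⟨none, rfl⟩
    | cast i => exact ⟨some (Sum.inr i), rfl⟩

/-- The exponents `b_j` of the last block variable against the others. -/
def lastExp (c w m : ℕ) : Fin w ⊕ Fin m → ℕ := Sum.elim (fun _ => c) fun _ => c + 1

theorem prod_prod_Ioi_castSucc {A : Type*} [CommMonoid A] {m : ℕ}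
    (f : Fin (m + 1) → Fin (m + 1) → A) :
    ∏ i, ∏ j ∈ Ioi i, f i j =
      (∏ i : Fin m, ∏ j ∈ Ioi i, f i.castSucc j.castSucc) *
        ∏ i : Fin m, f i.castSucc (Fin.last m) := by
  have h : ∀ i : Fin m, Ioi i.castSucc =
      insert (Fin.last m) ((Ioi i).map Fin.castSuccEmb) := by
    intro i
    ext j
    induction j using Fin.lastCases with
    | last => simp [Fin.castSucc_lt_last]
    | cast j => simpa using fun _ => Fin.le_last _
  rw [Fin.prod_univ_castSucc]
  have hl : Ioi (Fin.last m) = ∅ := by ext; simp [Fin.le_last]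
  rw [hl, prod_empty, mul_one, ← prod_mul_distrib]
  refine prod_congr rfl fun i _ => ?_
  rw [h, prod_insert (by simp), prod_map, mul_comm]
  rfl

theorem pairFactor_succ_right {S : Type*} [CommRing S] (q x y : S) (a b : ℕ) :
    pairFactor q x y a (b + 1) = pairFactor q x y a b * (x - q ^ (b + 1) * y) := by
  rw [pairFactor, pairFactor, prod_range_succ]
  ring

/-- The `r = 0` factor is `y - x`; the remaining factors are symmetric in `x` and `y`. -/
theorem pairFactor_succ_self_antisymm {S : Type*} [CommRing S] (q x y : S) (c : ℕ) :
    pairFactor q x y (c + 1) c = -pairFactor q y x (c + 1) c := by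
  simp only [pairFactor, prod_range_succ' _ c, pow_zero]
  ring

end Polynomial

/-! ### Splitting off the last block variable -/

section Symmetrization

variable {K : Type*} [Field K] (q : K) (c w m : ℕ) (e : Fin w → Fin w → ℕ)

/-- The factor of `ctPoly` that is antisymmetric in the block. -/
def antisymmPart : MvPolynomial (Fin w ⊕ Fin m) K :=
  (∏ i, ∏ j ∈ Ioi i, pairFactor (MvPolynomial.C q) (MvPolynomial.X (Sum.inl i))
    (MvPolynomial.X (Sum.inl j)) (e i j) (e i j)) *
  ((∏ i : Fin w, ∏ j : Fin m, pairFactor (MvPolynomial.C q) (MvPolynomial.X (Sum.inl i))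
    (MvPolynomial.X (Sum.inr j)) c c) *
  ∏ i : Fin m, ∏ j ∈ Ioi i, pairFactor (MvPolynomial.C q) (MvPolynomial.X (Sum.inr i))
    (MvPolynomial.X (Sum.inr j)) (c + 1) c)

/-- The product `∏_{i<j} (x_i - t x_j)` with `t = q ^ (c + 1)`. -/
def tVandermonde : MvPolynomial (Fin m) K :=
  ∏ i : Fin m, ∏ j ∈ Ioi i,
    (MvPolynomial.X i - MvPolynomial.C (q ^ (c + 1)) * MvPolynomial.X j)

/-- The last factor of each block pair, with exponents `(c + 1, c + 1)`, is `x_i - q ^ (c + 1) x_j`.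
-/
theorem ctPoly_eq_antisymmPart_mul : ctPoly q c w m e =
    antisymmPart q c w m e * MvPolynomial.rename Sum.inr (tVandermonde q c m) := by
  simp only [ctPoly, antisymmPart, tVandermonde, pairFactor_succ_right, prod_mul_distrib, map_prod,
    map_sub, map_mul, MvPolynomial.rename_X, MvPolynomial.rename_C, map_pow]
  ring

theorem rename_swap_antisymmPart {u v : Fin m} (huv : u ≠ v) :
    MvPolynomial.rename (Equiv.swap (Sum.inr u) (Sum.inr v)) (antisymmPart q c w m e) =
      -antisymmPart q c w m e := by
  have hl : ∀ i : Fin w, Equiv.swap (Sum.inr u : Fin w ⊕ Fin m) (Sum.inr v) (Sum.inl i) =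
      Sum.inl i := fun i => Equiv.swap_apply_of_ne_of_ne (by simp) (by simp)
  have hr : ∀ i : Fin m, Equiv.swap (Sum.inr u : Fin w ⊕ Fin m) (Sum.inr v) (Sum.inr i) =
      Sum.inr (Equiv.swap u v i) := fun i => Sum.inr_injective.swap_apply u v i
  have hp : ∀ (x y : MvPolynomial (Fin w ⊕ Fin m) K) (a b : ℕ),
      MvPolynomial.rename (Equiv.swap (Sum.inr u : Fin w ⊕ Fin m) (Sum.inr v))
        (pairFactor (MvPolynomial.C q) x y a b) = pairFactor (MvPolynomial.C q)
          (MvPolynomial.rename (Equiv.swap (Sum.inr u) (Sum.inr v)) x)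
          (MvPolynomial.rename (Equiv.swap (Sum.inr u) (Sum.inr v)) y) a b := by
    intro x y a b
    have := map_pairFactor (MvPolynomial.rename (R := K)
      (Equiv.swap (Sum.inr u : Fin w ⊕ Fin m) (Sum.inr v))).toRingHom (MvPolynomial.C q) x y a b
    simpa using this
  simp only [antisymmPart, map_mul, map_prod, hp, MvPolynomial.rename_X, hl, hr]
  have h1 : ∀ i : Fin w, ∏ j : Fin m, pairFactor (MvPolynomial.C q)
      (MvPolynomial.X (Sum.inl i) : MvPolynomial (Fin w ⊕ Fin m) K)
      (MvPolynomial.X (Sum.inr (Equiv.swap u v j))) c c =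
      ∏ j : Fin m, pairFactor (MvPolynomial.C q) (MvPolynomial.X (Sum.inl i))
        (MvPolynomial.X (Sum.inr j)) c c := fun i =>
    Equiv.prod_comp (Equiv.swap u v) fun j => pairFactor (MvPolynomial.C q)
      (MvPolynomial.X (Sum.inl i) : MvPolynomial (Fin w ⊕ Fin m) K)
      (MvPolynomial.X (Sum.inr j)) c c
  have h2 := (Equiv.swap u v).prod_Ioi_comp_eq_sign_mul_prod
    (f := fun i j => pairFactor (MvPolynomial.C q)
      (MvPolynomial.X (Sum.inr i) : MvPolynomial (Fin w ⊕ Fin m) K)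
      (MvPolynomial.X (Sum.inr j)) (c + 1) c)
    fun i j => pairFactor_succ_self_antisymm _ _ _ _
  simp only [h1, h2, Equiv.Perm.sign_swap huv]
  simp

/-- Extraction of the constant term against the antisymmetric part. -/
def antisymmCoeff : MvPolynomial (Fin w ⊕ Fin m) K →ₗ[K] K :=
  MvPolynomial.lcoeff K (ctWeight c w m e) ∘ₗ LinearMap.mulLeft K (antisymmPart q c w m e)

theorem antisymmCoeff_apply (f : MvPolynomial (Fin w ⊕ Fin m) K) :
    antisymmCoeff q c w m e f = (antisymmPart q c w m e * f).coeff (ctWeight c w m e) := rfl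

/-- Besides the sign of `antisymmPart`, this uses that `ctWeight` gives all block variables the same
exponent. -/
theorem isAntisymmOn_antisymmCoeff :
    IsAntisymmOn (antisymmCoeff q c w m e) (Set.range Sum.inr) := by
  rintro _ ⟨u, rfl⟩ _ ⟨v, rfl⟩ huv f
  have huv' : u ≠ v := fun h => huv (by rw [h])
  set σ := Equiv.swap (Sum.inr u : Fin w ⊕ Fin m) (Sum.inr v) with hσ
  have h1 : antisymmPart q c w m e * MvPolynomial.rename σ f =
      -MvPolynomial.rename σ (antisymmPart q c w m e * f) := by
    rw [map_mul, rename_swap_antisymmPart q c w m e huv']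
    ring
  have h2 : ctWeight c w m e = Finsupp.mapDomain σ (ctWeight c w m e) := by
    ext x
    conv_rhs => rw [← Equiv.swap_apply_self (Sum.inr u) (Sum.inr v) x, ← hσ,
      Finsupp.mapDomain_apply σ.injective]
    rw [hσ, Equiv.swap_apply_def]
    split_ifs with h h'
    · rw [h, ctWeight_inr, ctWeight_inr]
    · rw [h', ctWeight_inr, ctWeight_inr]
    · rfl
  rw [antisymmCoeff_apply, antisymmCoeff_apply, h1, MvPolynomial.coeff_neg]
  conv_lhs => rw [h2]
  rw [MvPolynomial.coeff_rename_mapDomain _ σ.injective]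

/-- The last block variable taken out, with its `b_j` factors. -/
def extendPoly : MvPolynomial (Option (Fin w ⊕ Fin m)) K :=
  MvPolynomial.rename some (ctPoly q c w m e) * ∏ j, pairFactor (MvPolynomial.C q)
    (MvPolynomial.X (some j)) (MvPolynomial.X none) (lastExp c w m j) c

/-- The factors `x_i - t x_o` with the last variable are absent on both sides: they are the ones
that symmetrization has replaced by monomials. -/
theorem rename_extendPoly : MvPolynomial.rename addLast (extendPoly q c w m e) =
    antisymmPart q c w (m + 1) e *
      MvPolynomial.rename (fun i : Fin m => Sum.inr i.castSucc) (tVandermonde q c m) := by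
  have hp : ∀ (x y : MvPolynomial (Option (Fin w ⊕ Fin m)) K) (a b : ℕ),
      MvPolynomial.rename addLast (pairFactor (MvPolynomial.C q) x y a b) =
        pairFactor (MvPolynomial.C q) (MvPolynomial.rename addLast x)
          (MvPolynomial.rename addLast y) a b := by
    intro x y a b
    have := map_pairFactor (MvPolynomial.rename (R := K) (addLast (w := w) (m := m))).toRingHom
      (MvPolynomial.C q) x y a b
    simpa using this
  have hp' : ∀ (x y : MvPolynomial (Fin w ⊕ Fin m) K) (a b : ℕ),
      MvPolynomial.rename (addLast ∘ some) (pairFactor (MvPolynomial.C q) x y a b) =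
        pairFactor (MvPolynomial.C q) (MvPolynomial.rename (addLast ∘ some) x)
          (MvPolynomial.rename (addLast ∘ some) y) a b := by
    intro x y a b
    have := map_pairFactor (MvPolynomial.rename (R := K) (addLast (w := w) (m := m) ∘ some)).toRingHom
      (MvPolynomial.C q) x y a b
    simpa using this
  rw [extendPoly, map_mul, MvPolynomial.rename_rename, ctPoly_eq_antisymmPart_mul, antisymmPart,
    antisymmPart]
  rw [prod_prod_Ioi_castSucc]
  simp only [Fin.prod_univ_castSucc, map_mul, map_prod, hp, hp', MvPolynomial.rename_X,
    MvPolynomial.rename_rename, Fintype.prod_sum_type, lastExp, Sum.elim_inl, Sum.elim_inr,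
    prod_mul_distrib]
  simp only [addLast, Function.comp_apply, Option.elim_some, Option.elim_none, Sum.map_inl,
    Sum.map_inr, id_eq]
  have : (addLast ∘ some) ∘ Sum.inr = fun i : Fin m => (Sum.inr i.castSucc : Fin w ⊕ Fin (m + 1)) :=
    rfl
  rw [this]
  ring

/-- The final sum is the exponent of `∏ x_i` over the earlier block variables, the monomial that
symmetrization leaves behind. -/
theorem ctWeight_succ : ctWeight c w (m + 1) e =
    Finsupp.mapDomain addLast (Finsupp.equivFunOnFinite.symm fun o : Option (Fin w ⊕ Fin m) =>
      o.elim (c * (w + m) + m) fun j => c + ctWeight c w m e j) +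
    ∑ i : Fin m, Finsupp.single (Sum.inr i.castSucc) 1 := by
  ext v
  obtain ⟨o, rfl⟩ := addLast_surjective v
  rw [Finsupp.add_apply, Finsupp.mapDomain_apply addLast_injective, Finsupp.finsetSum_apply]
  rcases o with _ | i | i
  · simp only [addLast, Option.elim_none, ctWeight_inr, Finsupp.equivFunOnFinite_symm_apply_apply,
      Finsupp.single_apply, Sum.inr.injEq, Fin.castSucc_ne_last, if_false, sum_const_zero]
    simp only [Nat.add_sub_cancel]
    ring
  · simp only [addLast, Option.elim_some, Sum.map_inl, id_eq, ctWeight_inl,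
      Finsupp.equivFunOnFinite_symm_apply_apply, Finsupp.single_apply, reduceCtorEq, if_false,
      sum_const_zero]
    ring
  · simp only [addLast, Option.elim_some, Sum.map_inr, ctWeight_inr,
      Finsupp.equivFunOnFinite_symm_apply_apply, Finsupp.single_apply, Sum.inr.injEq,
      Fin.castSucc_inj, sum_ite_eq', mem_univ, if_true]
    obtain ⟨m', rfl⟩ : ∃ m', m = m' + 1 := ⟨m - 1, by have := i.2; omega⟩
    simp only [Nat.add_sub_cancel]
    ring

theorem ctCoeff_succ_eq_sum_mul [CharZero K] : ctCoeff q c w (m + 1) e =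
    (∑ i ∈ range (m + 1), (q ^ (c + 1)) ^ i) * (extendPoly q c w m e).coeff
      (Finsupp.equivFunOnFinite.symm fun o : Option (Fin w ⊕ Fin m) =>
        o.elim (c * (w + m) + m) fun j => c + ctWeight c w m e j) := by
  have hT : tVandermonde q c (m + 1) =
      MvPolynomial.rename Fin.castSucc (tVandermonde q c m) *
        ∏ i : Fin m, (MvPolynomial.X i.castSucc -
          MvPolynomial.C (q ^ (c + 1)) * MvPolynomial.X (Fin.last m)) := by
    rw [tVandermonde, prod_prod_Ioi_castSucc]
    simp [tVandermonde]
  have key := map_rename_mul_prod_sub (isAntisymmOn_antisymmCoeff q c w (m + 1) e)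
    (φ := fun i : Fin m => Sum.inr i.castSucc) (o := Sum.inr (Fin.last m))
    (fun i j h => by simpa using h) (fun i => ⟨_, rfl⟩) ⟨_, rfl⟩
    (fun i h => by simp at h) (q ^ (c + 1)) (tVandermonde q c m)
    (support_prod_sub_lt _)
  rw [antisymmCoeff_apply, antisymmCoeff_apply] at key
  rw [ctCoeff, ctPoly_eq_antisymmPart_mul, hT, map_mul, MvPolynomial.rename_rename]
  simp only [map_prod, map_sub, map_mul, MvPolynomial.rename_X, MvPolynomial.rename_C] at key ⊢
  refine key.trans ?_
  congr 1
  have hX : ∏ i : Fin m, (MvPolynomial.X (Sum.inr i.castSucc) :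
      MvPolynomial (Fin w ⊕ Fin (m + 1)) K) =
      MvPolynomial.monomial (∑ i : Fin m, Finsupp.single (Sum.inr i.castSucc) 1) 1 := by
    rw [MvPolynomial.monomial_sum_one]
    rfl
  rw [← mul_assoc, ← rename_extendPoly, hX, ctWeight_succ, MvPolynomial.coeff_mul_monomial, mul_one,
    MvPolynomial.coeff_rename_mapDomain _ addLast_injective]

end Symmetrization

/-! ### The recursion, generically and over every commutative ring -/

section Recursion

variable {K : Type*} [Field K] {q : K}

/-- The pair exponents in `ctPoly` dominate the interval lengths: `c` if an outer variable is
involved, by `hec`, and `c + 1` inside the block. Hence nonvanishing separates the intervals. The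
bound `he` keeps those of the outer variables within the segment. -/
theorem coeff_extendPoly (hq0 : q ≠ 0) (hq : ∀ m : ℕ, 1 ≤ m → q ^ m ≠ 1) {c w m : ℕ}
    {e : Fin w → Fin w → ℕ} (hec : ∀ i j, c ≤ e i j)
    (he : ∀ i, ∑ j ∈ Ioi i, e i j + ∑ j ∈ Iio i, e j i + c ≤ w * c + m) :
    (extendPoly q c w m e).coeff
      (Finsupp.equivFunOnFinite.symm fun o : Option (Fin w ⊕ Fin m) =>
        o.elim (c * (w + m) + m) fun j => c + ctWeight c w m e j) *
      ∏ r ∈ range (c * (w + m) + m), (1 - q ^ (r + 1)) =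
    (∏ r ∈ range (c * (w + m) + m), (1 - q ^ (c + r + 1))) * ctCoeff q c w m e := by
  have := coeff_mul_prod_pairFactor hq0 hq (c := c) (b := lastExp c w m) (d := ctWeight c w m e)
    (M := c * (w + m) + m) (isHomogeneous_ctPoly q c w m e) ?_ ?_ ?_
  · have hs : Finsupp.equivFunOnFinite.symm (ctWeight c w m e) = ctWeight c w m e := by
      ext; simp
    rw [hs] at this
    exact this
  · intro k hk
    have hdis : ∀ {x y : Fin w ⊕ Fin m} {a b : ℕ}, MvPolynomial.eval (fun j => q ^ k j)
        (pairFactor (MvPolynomial.C q) (MvPolynomial.X x) (MvPolynomial.X y) a b) ≠ 0 →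
        k x + a ≤ k y ∨ k y + b + 1 ≤ k x := by
      intro x y a b h
      rw [map_pairFactor] at h
      simp only [MvPolynomial.eval_C, MvPolynomial.eval_X] at h
      exact le_or_le_of_pairFactor_ne_zero h
    rw [ctPoly, map_mul, map_mul] at hk
    have hk1 := left_ne_zero_of_mul hk
    have hk2 := left_ne_zero_of_mul (right_ne_zero_of_mul hk)
    have hk3 := right_ne_zero_of_mul (right_ne_zero_of_mul hk)
    simp only [map_prod, prod_ne_zero_iff, mem_univ, forall_const, mem_Ioi] at hk1 hk2 hk3
    rintro (i | i) (j | j) hij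
    · simp only [lastExp, Sum.elim_inl]
      rcases lt_or_gt_of_ne (fun h => hij (by rw [h]) : i ≠ j) with h | h
      · have := hdis (hk1 i j h)
        have := hec i j
        omega
      · have := hdis (hk1 j i h)
        have := hec j i
        omega
    · simp only [lastExp, Sum.elim_inl, Sum.elim_inr]
      have := hdis (hk2 i j)
      omega
    · simp only [lastExp, Sum.elim_inl, Sum.elim_inr]
      have := hdis (hk2 j i)
      omega
    · simp only [lastExp, Sum.elim_inr]
      rcases lt_or_gt_of_ne (fun h => hij (by rw [h]) : i ≠ j) with h | h
      · have := hdis (hk3 i j h)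
        omega
      · have := hdis (hk3 j i h)
        omega
  · simp [lastExp, Fintype.sum_sum_type]
    ring
  · rintro (i | i)
    · rw [ctWeight_inl]
      simp only [lastExp, Sum.elim_inl]
      have := he i
      nlinarith
    · rw [ctWeight_inr]
      simp only [lastExp, Sum.elim_inr]
      obtain ⟨m', rfl⟩ : ∃ m', m = m' + 1 := ⟨m - 1, by have := i.2; omega⟩
      simp only [Nat.add_sub_cancel]
      nlinarith

/-- The recursion for `q` not a root of unity in characteristic zero. -/
theorem ctCoeff_succ_of_generic [CharZero K] (hq0 : q ≠ 0) (hq : ∀ m : ℕ, 1 ≤ m → q ^ m ≠ 1)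
    {c w m : ℕ} {e : Fin w → Fin w → ℕ} (hec : ∀ i j, c ≤ e i j)
    (he : ∀ i, ∑ j ∈ Ioi i, e i j + ∑ j ∈ Iio i, e j i + c ≤ w * c + m) :
    ctCoeff q c w (m + 1) e * ((1 - q ^ (c + 1)) * qPoch q q c) =
      (1 - q ^ ((m + 1) * (c + 1))) * qPoch q (q ^ (c * (w + m) + m + 1)) c *
        ctCoeff q c w m e := by
  have h := coeff_extendPoly hq0 hq hec he
  have h1 := ctCoeff_succ_eq_sum_mul q c w m e
  set M := c * (w + m) + m with hM
  set P := (extendPoly q c w m e).coeff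
      (Finsupp.equivFunOnFinite.symm fun o : Option (Fin w ⊕ Fin m) =>
        o.elim M fun j => c + ctWeight c w m e j) with hP
  have hgeom : (∑ i ∈ range (m + 1), (q ^ (c + 1)) ^ i) * (1 - q ^ (c + 1)) =
      1 - q ^ ((m + 1) * (c + 1)) := by
    rw [geom_sum_mul_neg, ← pow_mul, mul_comm (c + 1)]
  -- Both sides are the product of `1 - q ^ (r + 1)` over `r < M + c`, split at `c` and at `M`.
  have hA : (∏ r ∈ range c, (1 - q ^ (r + 1))) * ∏ r ∈ range M, (1 - q ^ (c + r + 1)) =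
      (∏ r ∈ range M, (1 - q ^ (r + 1))) * ∏ r ∈ range c, (1 - q ^ (M + r + 1)) := by
    rw [← prod_range_add (fun r => 1 - q ^ (r + 1)), ← prod_range_add (fun r => 1 - q ^ (r + 1)),
      add_comm]
  have hB : ∏ r ∈ range M, ((1 : K) - q ^ (r + 1)) ≠ 0 := prod_ne_zero_iff.2 fun r _ h =>
    hq (r + 1) (by omega) (sub_eq_zero.1 h).symm
  have e1 : qPoch q q c = ∏ r ∈ range c, (1 - q ^ (r + 1)) :=
    prod_congr rfl fun r _ => by ring
  have e2 : qPoch q (q ^ (M + 1)) c = ∏ r ∈ range c, (1 - q ^ (M + r + 1)) :=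
    prod_congr rfl fun r _ => by ring
  rw [e1, e2, h1, ← hgeom]
  refine mul_right_cancel₀ hB ?_
  linear_combination (∑ i ∈ range (m + 1), (q ^ (c + 1)) ^ i) * (1 - q ^ (c + 1)) *
    ((∏ r ∈ range c, (1 - q ^ (r + 1))) * h + ctCoeff q c w m e * hA)

/-- The recursion over every commutative ring. -/
theorem ctCoeff_succ {R : Type*} [CommRing R] (q : R)
    {c w m : ℕ} {e : Fin w → Fin w → ℕ} (hec : ∀ i j, c ≤ e i j)
    (he : ∀ i, ∑ j ∈ Ioi i, e i j + ∑ j ∈ Iio i, e j i + c ≤ w * c + m) :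
    ctCoeff q c w (m + 1) e * ((1 - q ^ (c + 1)) * qPoch q q c) =
      (1 - q ^ ((m + 1) * (c + 1))) * qPoch q (q ^ (c * (w + m) + m + 1)) c *
        ctCoeff q c w m e := by
  have hpoch : ∀ {S T : Type} [CommRing S] [CommRing T] (f : S →+* T) (u a : S) (z : ℕ),
      f (qPoch u a z) = qPoch (f u) (f a) z := by
    intro S T _ _ f u a z
    simp [qPoch]
  have hZ : ctCoeff (Polynomial.X : Polynomial ℤ) c w (m + 1) e *
      ((1 - Polynomial.X ^ (c + 1)) * qPoch Polynomial.X Polynomial.X c) =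
      (1 - Polynomial.X ^ ((m + 1) * (c + 1))) *
        qPoch Polynomial.X (Polynomial.X ^ (c * (w + m) + m + 1)) c *
        ctCoeff Polynomial.X c w m e := by
    have hinj := IsFractionRing.injective (Polynomial ℤ) (FractionRing (Polynomial ℤ))
    have : CharZero (FractionRing (Polynomial ℤ)) := charZero_of_injective_algebraMap hinj
    apply hinj
    have := ctCoeff_succ_of_generic
      (q := algebraMap (Polynomial ℤ) (FractionRing (Polynomial ℤ)) Polynomial.X)
      (by rw [Ne, map_eq_zero_iff _ hinj]; exact Polynomial.X_ne_zero) (by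
        intro k hk h
        rw [← map_pow, ← map_one (algebraMap (Polynomial ℤ) (FractionRing (Polynomial ℤ)))] at h
        have := congrArg Polynomial.natDegree (hinj h)
        simp at this
        omega) hec he
    simpa only [map_mul, map_sub, map_one, map_pow, hpoch, map_ctCoeff] using this
  -- Specialization `X ↦ q`; nothing has been divided by, so roots of unity and positive
  -- characteristic do no harm.
  have := congrArg (Polynomial.eval₂RingHom (Int.castRingHom R) q) hZ
  simp only [map_mul, map_sub, map_one, map_pow, map_ctCoeff, Polynomial.coe_eval₂RingHom,
    Polynomial.eval₂_X, qPoch, map_prod] at this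
  simpa [qPoch] using this

end Recursion

/-! ### Products over pairs -/

section TriangularProducts

variable {A : Type*} [CommMonoid A]

/-- The product of `f i j` over `0 ≤ i < j < n`. -/
def triProd (f : ℕ → ℕ → A) (n : ℕ) : A := ∏ j ∈ range n, ∏ i ∈ range j, f i j

theorem triProd_succ (f : ℕ → ℕ → A) (n : ℕ) :
    triProd f (n + 1) = triProd f n * ∏ i ∈ range n, f i n := prod_range_succ _ _

theorem triProd_add (f : ℕ → ℕ → A) (n n' : ℕ) :
    triProd f (n + n') = triProd f n * ((∏ i ∈ range n, ∏ j ∈ range n', f i (n + j)) *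
      triProd (fun i j => f (n + i) (n + j)) n') := by
  induction n' with
  | zero => simp [triProd]
  | succ n' ih =>
    rw [← add_assoc, triProd_succ, ih, triProd_succ, prod_range_add]
    simp only [prod_range_succ, prod_mul_distrib]
    simp only [mul_assoc, mul_comm, mul_left_comm]

theorem triProd_congr {f g : ℕ → ℕ → A} {n : ℕ} (h : ∀ i j, i < j → j < n → f i j = g i j) :
    triProd f n = triProd g n :=
  prod_congr rfl fun j hj => prod_congr rfl fun i hi =>
    h i j (mem_range.1 hi) (mem_range.1 hj)

theorem prod_Ioi_eq_triProd (f : ℕ → ℕ → A) (n : ℕ) :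
    ∏ i : Fin n, ∏ j ∈ Ioi i, f i j = triProd f n := by
  induction n with
  | zero => simp [triProd]
  | succ n ih =>
    rw [prod_prod_Ioi_castSucc, triProd_succ, prod_range]
    simp only [Fin.val_castSucc, Fin.val_last, ih]

theorem prod_Icc_Ioc_eq_triProd (f : ℕ → ℕ → A) (n : ℕ) :
    ∏ i ∈ Icc 1 n, ∏ j ∈ Ioc i n, f i j = triProd (fun i j => f (i + 1) (j + 1)) n := by
  induction n with
  | zero => simp [triProd]
  | succ n ih =>
    rw [triProd_succ, ← ih, prod_Icc_succ_top (by omega), Ioc_self, prod_empty, mul_one]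
    have : ∏ i ∈ range n, f (i + 1) (n + 1) = ∏ i ∈ Icc 1 n, f i (n + 1) := by
      rw [range_eq_Ico, prod_Ico_add' (fun i => f i (n + 1)) 0 n 1]
      rfl
    rw [this, ← prod_mul_distrib]
    refine prod_congr rfl fun i hi => ?_
    rw [mem_Icc] at hi
    exact prod_Ioc_succ_top hi.2 (f i)

end TriangularProducts

/-! ### From Laurent polynomials to polynomials -/

section Laurent

variable {K : Type*} [Field K]

/-- The factor of `bfProduct` that belongs to a pair of variables. -/
def pairLaurent (q : K) (E i j : ℕ) : Laurent K :=
  qPoch (scalar q) (ratio K i j) E * qPoch (scalar q) (scalar q * ratio K j i) E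

/-- The weight of the variables `x_i` with `i ≤ B`. -/
def scaleDeg (B : ℕ) : (ℕ →₀ ℤ) →+ ℤ :=
  Finsupp.liftAddHom fun i => if i ≤ B then AddMonoidHom.id ℤ else 0

/-- The substitution `x_i ↦ q x_i` for `i ≤ B`. -/
def scaleHom (q : K) (hq0 : q ≠ 0) (B : ℕ) : Laurent K →ₐ[K] Laurent K :=
  AddMonoidAlgebra.lift K (Laurent K) (ℕ →₀ ℤ)
    { toFun := fun e => AddMonoidAlgebra.single e.toAdd (q ^ scaleDeg B e.toAdd)
      map_one' := by simp [AddMonoidAlgebra.one_def]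
      map_mul' := fun x y => by
        simp [AddMonoidAlgebra.single_mul_single, zpow_add₀ hq0] }

variable {q : K} (hq0 : q ≠ 0) (B : ℕ)

theorem scaleHom_single (e : ℕ →₀ ℤ) (r : K) :
    scaleHom q hq0 B (AddMonoidAlgebra.single e r) =
      AddMonoidAlgebra.single e (r * q ^ scaleDeg B e) := by
  simp [scaleHom, AddMonoidAlgebra.lift_single]

theorem coeff_zero_scaleHom (f : Laurent K) : (scaleHom q hq0 B f).coeff 0 = f.coeff 0 := by
  induction f using AddMonoidAlgebra.induction_linear with
  | zero => simp
  | add f g hf hg => simp [hf, hg]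
  | single e r =>
    rw [scaleHom_single, AddMonoidAlgebra.coeff_single, AddMonoidAlgebra.coeff_single]
    rcases eq_or_ne e 0 with rfl | h
    · simp
    · simp [h]

theorem scaleHom_ratio (i j : ℕ) : scaleHom q hq0 B (ratio K i j) =
    AddMonoidAlgebra.single (Finsupp.single i 1 - Finsupp.single j 1)
      (q ^ ((if i ≤ B then 1 else 0) - if j ≤ B then 1 else 0 : ℤ)) := by
  rw [ratio, scaleHom_single, one_mul, map_sub]
  congr 3 <;> · simp only [scaleDeg, Finsupp.liftAddHom_apply_single]; split_ifs <;> simp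

theorem scalar_mul_single (e : ℕ →₀ ℤ) (r : K) :
    scalar q * AddMonoidAlgebra.single e r = AddMonoidAlgebra.single e (q * r) := by
  simp [scalar, AddMonoidAlgebra.single_mul_single]

theorem scaleHom_scalar : scaleHom q hq0 B (scalar q) = scalar q := (scaleHom q hq0 B).commutes q

theorem scaleHom_qPoch (f : Laurent K) (z : ℕ) :
    scaleHom q hq0 B (qPoch (scalar q) f z) = qPoch (scalar q) (scaleHom q hq0 B f) z := by
  simp only [qPoch, map_prod, map_sub, map_one, map_mul, map_pow, scaleHom_scalar]

theorem scaleHom_pairLaurent_of_iff {i j : ℕ} (h : i ≤ B ↔ j ≤ B) (E : ℕ) :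
    scaleHom q hq0 B (pairLaurent q E i j) = pairLaurent q E i j := by
  rw [pairLaurent, map_mul, scaleHom_qPoch, scaleHom_qPoch, map_mul, scaleHom_ratio,
    scaleHom_ratio, scaleHom_scalar]
  simp [h, ratio]

/-- Scaling turns `x_i / x_j` into `q x_i / x_j` and `q x_j / x_i` into `x_j / x_i`, so it reverses
the order of a pair that straddles `B`. -/
theorem scaleHom_pairLaurent_of_le {i j : ℕ} (hi : i ≤ B) (hj : B < j) (E : ℕ) :
    scaleHom q hq0 B (pairLaurent q E i j) = pairLaurent q E j i := by
  rw [pairLaurent, map_mul, scaleHom_qPoch, scaleHom_qPoch, map_mul, scaleHom_ratio,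
    scaleHom_ratio, mul_comm, pairLaurent, scaleHom_scalar, scalar_mul_single, ratio, ratio, scalar_mul_single]
  simp [hi, not_le.2 hj, hq0]

/-- Exponent vectors of polynomials as exponent vectors of Laurent polynomials. -/
def expHom {ι : Type*} (g : ι → ℕ) : (ι →₀ ℕ) →+ (ℕ →₀ ℤ) :=
  (Finsupp.mapDomain.addMonoidHom g).comp
    (Finsupp.mapRange.addMonoidHom (Nat.castAddMonoidHom ℤ))

theorem expHom_injective {ι : Type*} {g : ι → ℕ} (hg : Function.Injective g) :
    Function.Injective (expHom g) :=
  (Finsupp.mapDomain_injective hg).comp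
    (Finsupp.mapRange_injective _ (by simp) Nat.cast_injective)

/-- Polynomials as Laurent polynomials. -/
def toLaurent {ι : Type*} (g : ι → ℕ) : MvPolynomial ι K →+* Laurent K :=
  AddMonoidAlgebra.mapDomainRingHom K (expHom g)

theorem coeff_toLaurent {ι : Type*} {g : ι → ℕ} (hg : Function.Injective g)
    (f : MvPolynomial ι K) (d : ι →₀ ℕ) : (toLaurent g f).coeff (expHom g d) = f.coeff d :=
  Finsupp.mapDomain_apply (expHom_injective hg) _ _

theorem toLaurent_monomial {ι : Type*} (g : ι → ℕ) (d : ι →₀ ℕ) (r : K) :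
    toLaurent g (MvPolynomial.monomial d r) = AddMonoidAlgebra.single (expHom g d) r :=
  AddMonoidAlgebra.mapDomain_single

theorem toLaurent_X {ι : Type*} (g : ι → ℕ) (u : ι) :
    toLaurent g (MvPolynomial.X u : MvPolynomial ι K) =
      AddMonoidAlgebra.single (Finsupp.single (g u) 1) 1 := by
  rw [MvPolynomial.X, toLaurent_monomial]
  simp [expHom]

theorem toLaurent_C {ι : Type*} (g : ι → ℕ) (r : K) :
    toLaurent g (MvPolynomial.C r : MvPolynomial ι K) = scalar r := by
  rw [MvPolynomial.C_apply, toLaurent_monomial, map_zero]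
  rfl

theorem ratio_mul_toLaurent_X {ι : Type*} (g : ι → ℕ) (u v : ι) :
    ratio K (g u) (g v) * toLaurent g (MvPolynomial.X v) = toLaurent g (MvPolynomial.X u) := by
  rw [toLaurent_X, toLaurent_X, ratio, AddMonoidAlgebra.single_mul_single]
  simp

theorem pairLaurent_mul {ι : Type*} (g : ι → ℕ) (u v : ι) (E : ℕ) :
    pairLaurent q E (g u) (g v) *
      toLaurent g (MvPolynomial.monomial (E • (Finsupp.single u 1 + Finsupp.single v 1)) 1) =
    toLaurent g (pairFactor (MvPolynomial.C q) (MvPolynomial.X u) (MvPolynomial.X v) E E) := by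
  have h : (MvPolynomial.monomial (E • (Finsupp.single u 1 + Finsupp.single v 1)) 1 :
      MvPolynomial ι K) = MvPolynomial.X v ^ E * MvPolynomial.X u ^ E := by
    rw [MvPolynomial.X_pow_eq_monomial, MvPolynomial.X_pow_eq_monomial,
      MvPolynomial.monomial_mul, smul_add, add_comm]
    simp
  have h1 := ratio_mul_toLaurent_X (K := K) g u v
  have h2 := ratio_mul_toLaurent_X (K := K) g v u
  rw [h, map_mul, map_pow, map_pow, map_pairFactor, toLaurent_C, pairLaurent, mul_mul_mul_comm,
    pairFactor]
  have hpow : ∀ x : Laurent K, x ^ E = ∏ _r ∈ range E, x := by simp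
  congr 1
  · rw [hpow, qPoch, ← prod_mul_distrib]
    refine prod_congr rfl fun r _ => ?_
    rw [← h1]
    ring
  · rw [hpow, qPoch, ← prod_mul_distrib]
    refine prod_congr rfl fun r _ => ?_
    rw [← h2]
    ring

/-- The positions `0, 1, …` of the variables outside the block of length `m` that starts at `a`,
read cyclically from the end of the block. -/
def outerPos (a m v i : ℕ) : ℕ := if i < v then a + m + i else i - v

/-- The variables of `ctPoly` as the variables `x_1, x_2, …`. -/
def varPos (a m v : ℕ) : Fin (v + a) ⊕ Fin m → ℕ :=
  Sum.elim (fun i => outerPos a m v i + 1) fun b => a + b + 1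

theorem varPos_injective (a m v : ℕ) : Function.Injective (varPos a m v) := by
  rintro (i | i) (j | j) h <;>
  · simp only [varPos, outerPos, Sum.elim_inl, Sum.elim_inr] at h
    have hi := i.2
    have hj := j.2
    first
    | (congr 1; ext; omega)
    | (congr 1; ext; split_ifs at h <;> omega)
    | (exfalso; split_ifs at h <;> omega)

theorem coeff_prod_pairLaurent_eq_ctCoeff (hq0 : q ≠ 0) {a m v c : ℕ} {E : ℕ → ℕ → ℕ}
    (hE : ∀ i j, E i j = E j i)
    (h1 : ∀ i < v + a, ∀ b < m, E (outerPos a m v i + 1) (a + b + 1) = c)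
    (h2 : ∀ b < m, ∀ b' < m, b ≠ b' → E (a + b + 1) (a + b' + 1) = c + 1) :
    (∏ i ∈ Icc 1 (a + m + v), ∏ j ∈ Ioc i (a + m + v), pairLaurent q (E i j) i j).coeff 0 =
      ctCoeff q c (v + a) m
        fun i j => E (outerPos a m v i + 1) (outerPos a m v j + 1) := by
  -- Scaling the variables up to the end of the block puts the `v` later ones first, then the `a`
  -- earlier ones, then the block.
  set g := varPos a m v with hg
  have hreorder : scaleHom q hq0 (a + m)
      (∏ i ∈ Icc 1 (a + m + v), ∏ j ∈ Ioc i (a + m + v), pairLaurent q (E i j) i j) =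
      (∏ i : Fin (v + a), ∏ j ∈ Ioi i,
        pairLaurent q (E (outerPos a m v i + 1) (outerPos a m v j + 1))
          (g (Sum.inl i)) (g (Sum.inl j))) *
      ((∏ i : Fin (v + a), ∏ b : Fin m, pairLaurent q c (g (Sum.inl i)) (g (Sum.inr b))) *
      ∏ b : Fin m, ∏ b' ∈ Ioi b, pairLaurent q (c + 1) (g (Sum.inr b)) (g (Sum.inr b'))) := by
    simp only [hg, varPos, Sum.elim_inl, Sum.elim_inr]
    rw [prod_Icc_Ioc_eq_triProd, prod_Ioi_eq_triProd fun i j =>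
      pairLaurent q (E (outerPos a m v i + 1) (outerPos a m v j + 1))
          (outerPos a m v i + 1) (outerPos a m v j + 1),
      prod_Ioi_eq_triProd fun i j => pairLaurent q (c + 1) (a + i + 1) (a + j + 1)]
    have hcross : ∏ i : Fin (v + a), ∏ b : Fin m,
        pairLaurent q c (outerPos a m v i + 1) (a + b + 1) =
        ∏ i ∈ range (v + a), ∏ b ∈ range m,
          pairLaurent q (E (outerPos a m v i + 1) (a + b + 1))
            (outerPos a m v i + 1) (a + b + 1) := by
      rw [prod_range]
      refine prod_congr rfl fun i _ => ?_
      rw [prod_range]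
      exact prod_congr rfl fun b _ => by rw [h1 i i.2 b b.2]
    have hblock : triProd (fun i j => pairLaurent q (c + 1) (a + i + 1) (a + j + 1)) m =
        triProd (fun i j => pairLaurent q (E (a + i + 1) (a + j + 1)) (a + i + 1) (a + j + 1))
          m :=
      triProd_congr fun i j hij hj => by rw [h2 i (by omega) j hj (by omega)]
    rw [hcross, hblock, triProd_add, triProd_add, triProd_add _ v a, prod_range_add _ v a]
    have hmap : ∀ (f : ℕ → ℕ → Laurent K) (n : ℕ), scaleHom q hq0 (a + m) (triProd f n) =
        triProd (fun i j => scaleHom q hq0 (a + m) (f i j)) n := by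
      intro f n
      simp [triProd]
    rw [prod_range_add _ a m]
    simp only [map_mul, map_prod, hmap]
    have s1 : triProd (fun i j => scaleHom q hq0 (a + m)
        (pairLaurent q (E (i + 1) (j + 1)) (i + 1) (j + 1))) a =
        triProd (fun i j => pairLaurent q (E (outerPos a m v (v + i) + 1)
          (outerPos a m v (v + j) + 1)) (outerPos a m v (v + i) + 1)
            (outerPos a m v (v + j) + 1)) a :=
      triProd_congr fun i j hij hj => by
        rw [scaleHom_pairLaurent_of_iff _ _ (by omega)]
        simp [outerPos]
    have s2 : triProd (fun i j => scaleHom q hq0 (a + m)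
        (pairLaurent q (E (a + i + 1) (a + j + 1)) (a + i + 1) (a + j + 1))) m =
        triProd (fun i j => pairLaurent q (E (a + i + 1) (a + j + 1)) (a + i + 1) (a + j + 1))
          m :=
      triProd_congr fun i j hij hj => scaleHom_pairLaurent_of_iff _ _ (by omega) _
    have s3 : triProd (fun i j => scaleHom q hq0 (a + m)
        (pairLaurent q (E (a + m + i + 1) (a + m + j + 1)) (a + m + i + 1) (a + m + j + 1))) v =
        triProd (fun i j => pairLaurent q (E (outerPos a m v i + 1)
          (outerPos a m v j + 1)) (outerPos a m v i + 1) (outerPos a m v j + 1)) v :=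
      triProd_congr fun i j hij hj => by
        rw [scaleHom_pairLaurent_of_iff _ _ (by omega)]
        simp [outerPos, hj, hij.trans hj]
    have s4 : ∏ i ∈ range a, ∏ j ∈ range m, scaleHom q hq0 (a + m)
        (pairLaurent q (E (i + 1) (a + j + 1)) (i + 1) (a + j + 1)) =
        ∏ i ∈ range a, ∏ j ∈ range m, pairLaurent q (E (outerPos a m v (v + i) + 1) (a + j + 1))
          (outerPos a m v (v + i) + 1) (a + j + 1) :=
      prod_congr rfl fun i hi => prod_congr rfl fun j hj => by
        rw [mem_range] at hi hj
        rw [scaleHom_pairLaurent_of_iff _ _ (by omega)]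
        simp [outerPos]
    have s5 : ∏ i ∈ range a, ∏ j ∈ range v, scaleHom q hq0 (a + m)
        (pairLaurent q (E (i + 1) (a + m + j + 1)) (i + 1) (a + m + j + 1)) =
        ∏ j ∈ range v, ∏ i ∈ range a, pairLaurent q
          (E (outerPos a m v j + 1) (outerPos a m v (v + i) + 1))
          (outerPos a m v j + 1) (outerPos a m v (v + i) + 1) := by
      rw [prod_comm]
      refine prod_congr rfl fun j hj => prod_congr rfl fun i hi => ?_
      rw [mem_range] at hi hj
      rw [scaleHom_pairLaurent_of_le _ _ (by omega) (by omega), hE]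
      simp [outerPos, hj]
    have s6 : ∏ i ∈ range m, ∏ j ∈ range v, scaleHom q hq0 (a + m)
        (pairLaurent q (E (a + i + 1) (a + m + j + 1)) (a + i + 1) (a + m + j + 1)) =
        ∏ j ∈ range v, ∏ i ∈ range m, pairLaurent q
          (E (outerPos a m v j + 1) (a + i + 1)) (outerPos a m v j + 1) (a + i + 1) := by
      rw [prod_comm]
      refine prod_congr rfl fun j hj => prod_congr rfl fun i hi => ?_
      rw [mem_range] at hi hj
      rw [scaleHom_pairLaurent_of_le _ _ (by omega) (by omega), hE]
      simp [outerPos, hj]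
    rw [s1, s2, s3, s4, s5, s6]
    ring
  set e : Fin (v + a) → Fin (v + a) → ℕ :=
    fun i j => E (outerPos a m v i + 1) (outerPos a m v j + 1) with he
  -- Multiplication by the monomial of exponent `ctWeight` clears all denominators, so the constant
  -- term becomes the coefficient at `ctWeight`.
  have hmono : (∏ i : Fin (v + a), ∏ j ∈ Ioi i,
        pairLaurent q (e i j) (g (Sum.inl i)) (g (Sum.inl j))) *
      ((∏ i : Fin (v + a), ∏ b : Fin m, pairLaurent q c (g (Sum.inl i)) (g (Sum.inr b))) *
      ∏ b : Fin m, ∏ b' ∈ Ioi b, pairLaurent q (c + 1) (g (Sum.inr b)) (g (Sum.inr b'))) *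
      toLaurent g (MvPolynomial.monomial (ctWeight c (v + a) m e) 1) =
      toLaurent g (ctPoly q c (v + a) m e) := by
    have hadd : ∀ x y : (Fin (v + a) ⊕ Fin m) →₀ ℕ,
        (MvPolynomial.monomial (x + y) 1 : MvPolynomial (Fin (v + a) ⊕ Fin m) K) =
          MvPolynomial.monomial x 1 * MvPolynomial.monomial y 1 := fun x y => by
      rw [MvPolynomial.monomial_mul, one_mul]
    simp only [ctWeight, ctPoly, hadd (∑ _, _), MvPolynomial.monomial_sum_one, map_mul, map_prod,
      ← pairLaurent_mul, prod_mul_distrib]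
    ring
  rw [← coeff_zero_scaleHom hq0 (a + m), hreorder, ctCoeff,
    ← coeff_toLaurent (varPos_injective a m v), ← hg, ← hmono, toLaurent_monomial]
  rw [AddMonoidAlgebra.coeff_mul_single_eq_coeff_mul 0 (by simp), mul_one]

end Laurent

/-! ### Blocks and the exponents `ε` -/

section Blocks

variable {p : ℕ} {n : Fin (p + 1) → ℕ}

theorem sum_Iic_eq_add (n : Fin (p + 1) → ℕ) (l : Fin (p + 1)) :
    ∑ x ∈ Iic l, n x = ∑ x ∈ Iio l, n x + n l := by
  have : Iic l = insert l (Iio l) := by ext; simp [le_iff_eq_or_lt]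
  rw [this, sum_insert (by simp), add_comm]

theorem sum_Iic_le_sum_Iio {l l' : Fin (p + 1)} (h : l < l') :
    ∑ x ∈ Iic l, n x ≤ ∑ x ∈ Iio l', n x :=
  sum_le_sum_of_subset fun x hx => by
    rw [mem_Iic] at hx
    exact mem_Iio.2 (hx.trans_lt h)

theorem eq_of_mem_block {i : ℕ} {l l' : Fin (p + 1)} (h : i ∈ block n l) (h' : i ∈ block n l') :
    l = l' := by
  rw [block, mem_Icc] at h h'
  rcases lt_trichotomy l l' with hl | hl | hl
  · have := sum_Iic_le_sum_Iio (n := n) hl; omega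
  · exact hl
  · have := sum_Iic_le_sum_Iio (n := n) hl; omega

theorem card_block (l : Fin (p + 1)) : (block n l).card = n l := by
  rw [block, Nat.card_Icc, sum_Iic_eq_add]
  omega

theorem eps_comm (i j : ℕ) : eps n i j = eps n j i := by
  simp only [eps, and_comm (a := i ∈ _)]

variable {k : Fin (p + 1)} {a m v : ℕ}

theorem bfConst_eq_ctCoeff {K : Type*} [Field K] {q : K} (hq0 : q ≠ 0) (c : ℕ) (hk : k ≠ 0)
    (ha : ∑ x ∈ Iio k, n x = a) (hm : n k = m) (hv : ∑ x, n x = a + m + v) :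
    bfConst q n 0 0 c = ctCoeff q c (v + a) m
      fun i j => c + eps n (outerPos a m v i + 1) (outerPos a m v j + 1) := by
  have hblock : block n k = Icc (a + 1) (a + m) := by
    rw [block, sum_Iic_eq_add, ha, hm]
  have h := coeff_prod_pairLaurent_eq_ctCoeff hq0 (a := a) (m := m) (v := v) (c := c)
    (E := fun i j => c + eps n i j) (fun i j => by rw [eps_comm]) ?_ ?_
  · rw [← h, bfConst, bfProduct, hv]
    simp [qPoch, pairLaurent]
  · intro i hi b hb
    rw [eps, if_neg, add_zero]
    rintro ⟨l, -, hl1, hl2⟩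
    have : a + b + 1 ∈ block n k := by rw [hblock, mem_Icc]; omega
    rw [eq_of_mem_block hl2 this, hblock, mem_Icc, outerPos] at hl1
    split_ifs at hl1 <;> omega
  · intro b hb b' hb' _
    rw [eps, if_pos]
    refine ⟨k, hk, ?_, ?_⟩ <;> · rw [hblock, mem_Icc]; omega

theorem sum_update_add_one {s : Finset (Fin (p + 1))} (hs : k ∈ s) (hm : n k = m + 1) :
    ∑ x ∈ s, Function.update n k m x + 1 = ∑ x ∈ s, n x := by
  rw [sum_update_of_mem hs, ← add_sum_erase _ _ hs, hm, sdiff_singleton_eq_erase]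
  ring

/-- Shrinking block `k` by one lowers every later position by one, and `outerPos` skips the block,
so outer variables keep their blocks. -/
theorem mem_block_update_iff (ha : ∑ x ∈ Iio k, n x = a) (hm : n k = m + 1) {i : ℕ}
    (hi : i < v + a) (l : Fin (p + 1)) :
    outerPos a m v i + 1 ∈ block (Function.update n k m) l ↔
      outerPos a (m + 1) v i + 1 ∈ block n l := by
  have hk := sum_Iic_eq_add n k
  rw [block, block, mem_Icc, mem_Icc, outerPos, outerPos]
  rcases lt_trichotomy l k with hl | hl | hl
  · have h1 := sum_Iic_le_sum_Iio (n := n) hl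
    rw [sum_update_of_notMem (by simp [hl.le]), sum_update_of_notMem (by simp [hl])]
    split_ifs <;> omega
  · subst hl
    have h1 := sum_update_add_one (s := Iic l) (by simp) hm
    rw [sum_update_of_notMem (by simp)]
    split_ifs <;> omega
  · have h1 := sum_update_add_one (s := Iic l) (by simp [hl.le]) hm
    have h2 := sum_update_add_one (s := Iio l) (by simp [hl]) hm
    have h3 := sum_Iic_le_sum_Iio (n := n) hl
    split_ifs <;> omega

theorem eps_update (ha : ∑ x ∈ Iio k, n x = a) (hm : n k = m + 1) {i j : ℕ}
    (hi : i < v + a) (hj : j < v + a) :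
    eps (Function.update n k m) (outerPos a m v i + 1) (outerPos a m v j + 1) =
      eps n (outerPos a (m + 1) v i + 1) (outerPos a (m + 1) v j + 1) := by
  simp only [eps, mem_block_update_iff ha hm hi, mem_block_update_iff ha hm hj]

/-- A variable shares its block with at most `n_l - 1 ≤ m` others, and variables of `N_0` contribute
nothing. This is where maximality of `n_k` over `l ≠ 0` enters. -/
theorem sum_eps_le (hmax : ∀ l : Fin (p + 1), l ≠ 0 → n l ≤ m + 1) {w : ℕ} {x : Fin w → ℕ}
    (hx : Function.Injective x) (i : Fin w) :
    ∑ j ∈ ({i}ᶜ : Finset (Fin w)), eps n (x i) (x j) ≤ m := by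
  by_cases h : ∃ l, l ≠ 0 ∧ x i ∈ block n l
  · obtain ⟨l, hl, hi⟩ := h
    have he : ∀ j, eps n (x i) (x j) = if x j ∈ block n l then 1 else 0 := by
      intro j
      refine if_congr ⟨?_, fun hj => ⟨l, hl, hi, hj⟩⟩ rfl rfl
      rintro ⟨l', -, h1, h2⟩
      rwa [eq_of_mem_block hi h1]
    simp only [he]
    rw [sum_boole, Nat.cast_id]
    have hcard : ((block n l).erase (x i)).card ≤ m := by
      rw [card_erase_of_mem hi, card_block]
      have := hmax l hl
      omega
    refine (card_le_card_of_injOn x ?_ hx.injOn).trans hcard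
    intro j hj
    simp only [coe_filter, mem_compl, mem_singleton, Set.mem_ofPred_eq] at hj
    simp only [coe_erase, Set.mem_sdiff, mem_coe, Set.mem_singleton_iff]
    exact ⟨hj.2, fun h => hj.1 (hx h)⟩
  · rw [sum_eq_zero]
    · exact Nat.zero_le _
    · intro j _
      rw [eps, if_neg]
      rintro ⟨l, hl, h1, -⟩
      exact h ⟨l, hl, h1⟩

theorem sum_add_eps_le (hmax : ∀ l : Fin (p + 1), l ≠ 0 → n l ≤ m + 1) {w : ℕ} {x : Fin w → ℕ}
    (hx : Function.Injective x) (c : ℕ) (i : Fin w) :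
    ∑ j ∈ Ioi i, (c + eps n (x i) (x j)) + ∑ j ∈ Iio i, (c + eps n (x j) (x i)) + c ≤
      w * c + m := by
  have h1 : ∑ j ∈ Ioi i, (c + eps n (x i) (x j)) + ∑ j ∈ Iio i, (c + eps n (x j) (x i)) =
      ∑ j ∈ ({i}ᶜ : Finset (Fin w)), (c + eps n (x i) (x j)) := by
    rw [← Ioi_disjUnion_Iio, sum_disjUnion]
    congr 1
    exact sum_congr rfl fun j _ => by rw [eps_comm]
  have h2 := sum_eps_le hmax hx i
  have hw : w - 1 + 1 = w := by have := i.2; omega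
  rw [h1, sum_add_distrib, sum_const, card_compl, card_singleton, Fintype.card_fin, smul_eq_mul]
  calc (w - 1) * c + ∑ j ∈ ({i}ᶜ : Finset (Fin w)), eps n (x i) (x j) + c
      = (w - 1 + 1) * c + ∑ j ∈ ({i}ᶜ : Finset (Fin w)), eps n (x i) (x j) := by ring
    _ ≤ w * c + m := by rw [hw]; omega

end Blocks

end BakerForrester

end

theorem mainTheorem3 {K : Type*} [Field K] (q : K) (hq0 : q ≠ 0) (c : ℕ)
    (hq : ∀ m : ℕ, 1 ≤ m → m ≤ c + 1 → q ^ m ≠ 1)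
    {p : ℕ} (n : Fin (p + 1) → ℕ) (k : Fin (p + 1)) (hk : k ≠ 0)
    (hmax : ∀ l : Fin (p + 1), l ≠ 0 → n l ≤ n k) (hpos : 1 ≤ n k) :
    BakerForrester.bfConst q n 0 0 c =
      (1 - q ^ (n k * (c + 1))) / (1 - q ^ (c + 1)) *
        BakerForrester.qBinom q ((∑ m, n m) * c + n k - 1) c *
        BakerForrester.bfConst q (Function.update n k (n k - 1)) 0 0 c := by
  open BakerForrester in
  obtain ⟨m, hm⟩ : ∃ m, n k = m + 1 := ⟨n k - 1, by omega⟩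
  obtain ⟨a, ha⟩ : ∃ a, ∑ x ∈ Finset.Iio k, n x = a := ⟨_, rfl⟩
  obtain ⟨v, hv⟩ : ∃ v, ∑ x, n x = a + (m + 1) + v := by
    have h1 := sum_Iic_eq_add n k
    have h2 : ∑ x ∈ Finset.Iic k, n x ≤ ∑ x, n x :=
      Finset.sum_le_sum_of_subset (Finset.subset_univ _)
    exact ⟨∑ x, n x - (a + (m + 1)), by omega⟩
  have hupd : bfConst q (Function.update n k m) 0 0 c = ctCoeff q c (v + a) m
      fun i j => c + eps n (outerPos a (m + 1) v i + 1) (outerPos a (m + 1) v j + 1) := by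
    rw [bfConst_eq_ctCoeff hq0 c hk (a := a) (m := m) (v := v)]
    · congr 1
      funext i j
      rw [eps_update ha hm i.2 j.2]
    · rw [Finset.sum_update_of_notMem (by simp), ha]
    · simp
    · have := sum_update_add_one (Finset.mem_univ k) hm
      omega
  have hinj : Function.Injective fun i : Fin (v + a) => outerPos a (m + 1) v i + 1 :=
    fun i j h => Sum.inl_injective (varPos_injective a (m + 1) v h)
  have hrec := ctCoeff_succ q (c := c) (w := v + a) (m := m)
    (e := fun i j => c + eps n (outerPos a (m + 1) v i + 1) (outerPos a (m + 1) v j + 1))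
    (fun i j => Nat.le_add_right _ _)
    (fun i => sum_add_eps_le (fun l hl => (hmax l hl).trans hm.le) hinj c i)
  rw [← hupd, ← bfConst_eq_ctCoeff hq0 c hk ha hm hv] at hrec
  -- The hypothesis on `q` serves only to divide by `1 - q ^ (c + 1)` and `(q)_c`.
  have hne : ∀ r, r ≤ c → 1 - q ^ (r + 1) ≠ 0 := fun r hr h =>
    hq (r + 1) (by omega) (by omega) (sub_eq_zero.1 h).symm
  have hpoch : qPoch q q c ≠ 0 := by
    refine Finset.prod_ne_zero_iff.2 fun r hr => ?_
    rw [Finset.mem_range] at hr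
    rw [← pow_succ']
    exact hne r hr.le
  -- Since the total is `v + a + m + 1`, the number `(∑ x, n x) * c` is at least `c`, so the
  -- truncated subtraction is exact.
  have hexp : (∑ x, n x) * c + n k - 1 + 1 - c = c * (v + a + m) + m + 1 := by
    have : (∑ x, n x) * c = c * (v + a + m) + c := by rw [hv]; ring
    omega
  have hc := hne c le_rfl
  rw [qBinom, hexp, hm, Nat.add_sub_cancel]
  field_simp
  linear_combination hrec
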